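/- Let $n\ge 3$. Let $\sigma_x=\begin{pmatrix}0&1\\1&0\end{pmatrix}$, $\sigma_y=\begin{pmatrix}0&i\\-i&0\end{pmatrix}$, $\sigma_z=\begin{pmatrix}1&0\\0&-1\end{pmatrix}$, and for a $2\times 2$ matrix $\sigma$ let $\sigma^j$ denote the $n$-fold tensor product with $\sigma$ in position $j$ and the identity $\mathbf 1$ in the other positions. Put $$H_0=\sum_{j=1}^{n-1}\sigma_z^j\sigma_z^{j+1}+\sigma_z^n\sigma_z^1,\qquad H_1=\sum_{j=1}^n\sigma_x^j ,$$ and let $\mathcal L$ be the real Lie algebra of $2^n\times 2^n$ complex matrices generated by $iH_0$ and $iH_1$ under the commutator. For a $2^n\times 2^n$ matrix $M$ let $\mathcal C(M)=\sum_{P\in C_n}PMP^T$, where $C_n$ is the cyclic group of order $n$ generated by the translation of the tensor factors, and define, for $0\le j\le n-2$, $$\mathbf Y^j=i\,\mathcal C(\sigma_y\otimes\sigma_x^{\otimes j}\otimes\sigma_y\otimes\mathbf 1^{\otimes n-j-2}),\qquad \mathbf Z^j=i\,\mathcal C(\sigma_z\otimes\sigma_x^{\otimes j}\otimes\sigma_z\otimes\mathbf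 1^{\otimes n-j-2}),$$ $$\mathbf{YZ}^j=i\,\mathcal C(\sigma_z\otimes\sigma_x^{\otimes j}\otimes\sigma_y\otimes\mathbf 1^{\otimes n-j-2})+i\,\mathcal C(\sigma_y\otimes\sigma_x^{\otimes j}\otimes\sigma_z\otimes\mathbf 1^{\otimes n-j-2}),$$ $$\mathbf X=i\,\mathcal C(\sigma_x\otimes\mathbf 1^{\otimes n-1}),\qquad \mathbf{XX}=i\,\mathcal C(\sigma_x^{\otimes n-1}\otimes\mathbf 1).$$ Let $a_0=1$, $a_1=\lambda$, $a_k=\lambda a_{k-1}-a_{k-2}$ for $k\ge 2$ (polynomials in $\lambda$), and let $A_{n-1}$ be the $(n-1)\times(n-1)$ tridiagonal matrix with $1$ directly above and below the diagonal and $0$ elsewhere. Then the following hold. 1. The matrices $\mathbf Y^k,\mathbf Z^k,\mathbf{YZ}^k$ ($k=0,\dots,n-2$), $\mathbf X$, $\mathbf{XX}$ form a basis of $\mathcal L$; in particular $\dim_{\mathbb R}\mathcal L=3n-1$. 2. The center of $\mathcal L$ is $2$-dimensional. If $n$ is odd it is spanned by $$-\mathbf X+\sum_{0\le k\le n-2,\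 k\text{ odd}}(\mathbf Y^k+\mathbf Z^k)\quad\text{and}\quad \mathbf{XX}+\sum_{0\le k\le n-2,\ k\text{ even}}(\mathbf Y^k+\mathbf Z^k);$$ if $n$ is even it is spanned by $$-\mathbf X+\mathbf{XX}+\sum_{0\le k\le n-2,\ k\text{ odd}}(\mathbf Y^k+\mathbf Z^k)\quad\text{and}\quad \sum_{0\le k\le n-2,\ k\text{ even}}(\mathbf Y^k+\mathbf Z^k).$$ 3. The polynomial $a_{n-1}$ has degree $n-1$ and exactly $n-1$ distinct real roots, and these are exactly the eigenvalues of $A_{n-1}$. 4. For each root $\bar\lambda$ of $a_{n-1}$ there is an ideal $\mathcal I_{\bar\lambda}$ of $\mathcal L$ with basis $$\hat X_{\bar\lambda}=a_0(\mathbf X+\mathbf Z^1)+a_{n-2}(\bar\lambda)(\mathbf{XX}-\mathbf Y^{n-3})+\sum_{k=1}^{n-3}a_k(\bar\lambda)(\mathbf Z^{k+1}-\mathbf Y^{k-1}),$$ $$\hat Y_{\bar\lambda}=\sum_{k=0}^{n-2}a_k(\bar\lambda)(\mathbf Y^k-\mathbf Z^k),\qquad \hat Z_{\bar\lambda}=\sum_{k=0}^{n-2}a_k(\bar\lambda)\,\mathbf{YZ}^k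 .$$ Each $\mathcal I_{\bar\lambda}$ is simple and isomorphic, as a real Lie algebra, to $su(2)$ (the skew-Hermitian traceless $2\times2$ complex matrices), and $\mathcal L$ is the direct sum of its center and the $n-1$ ideals $\mathcal I_{\bar\lambda}$. -/

import Mathlib

open scoped Matrix

attribute [local instance] LieRing.ofAssociativeRing

noncomputable section

namespace IsingChain

/-! Operators on the state space of `n` qubits are the complex matrices whose rows and columns are
indexed by the computational basis `Fin n → Fin 2`. -/

/-- Operators on `n` qubits. They form a Lie algebra over `ℝ` under the matrix commutator. -/
abbrev Op (n : ℕ) : Type := Matrix (Fin n → Fin 2) (Fin n → Fin 2) ℂ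

/-- The Pauli matrix `σ_x`. -/
def sigmaX : Matrix (Fin 2) (Fin 2) ℂ := !![0, 1; 1, 0]

/-- The Pauli matrix `σ_y`, with the sign convention `[iσ_x, iσ_y] = 2iσ_z`. -/
def sigmaY : Matrix (Fin 2) (Fin 2) ℂ := !![0, Complex.I; -Complex.I, 0]

/-- The Pauli matrix `σ_z`. -/
def sigmaZ : Matrix (Fin 2) (Fin 2) ℂ := !![1, 0; 0, -1]

/-- The tensor (Kronecker) product `s 0 ⊗ s 1 ⊗ ⋯ ⊗ s (n - 1)` of `2 × 2` matrices. -/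
def tensor {n : ℕ} (s : Fin n → Matrix (Fin 2) (Fin 2) ℂ) : Op n :=
  Matrix.of fun a b => ∏ i, s i (a i) (b i)

/-- `σ^j`: the tensor product with `σ` in position `j` and the identity in every other position. -/
def site {n : ℕ} (σ : Matrix (Fin 2) (Fin 2) ℂ) (j : Fin n) : Op n :=
  tensor (Function.update (fun _ => 1) j σ)

/-- The Ising interaction `H₀ = ∑_j σ_z^j σ_z^{j+1}` of the periodic chain; `finRotate n` is the
cyclic successor `j ↦ j + 1`, which sends the last site to the first one. -/
def H0 (n : ℕ) : Op n := ∑ j : Fin n, site sigmaZ j * site sigmaZ (finRotate n j)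

/-- The transverse field `H₁ = ∑_j σ_x^j`. -/
def H1 (n : ℕ) : Op n := ∑ j : Fin n, site sigmaX j

/-- The dynamical Lie algebra: the real Lie algebra of matrices generated by `iH₀` and `iH₁`. -/
def dla (n : ℕ) : LieSubalgebra ℝ (Op n) :=
  LieSubalgebra.lieSpan ℝ (Op n) {Complex.I • H0 n, Complex.I • H1 n}

/-- Conjugation `P A Pᵀ` by the unitary `P` that permutes the tensor factors by `π`. -/
def permConj {n : ℕ} (π : Equiv.Perm (Fin n)) (A : Op n) : Op n :=
  A.submatrix (fun a => a ∘ π) (fun a => a ∘ π)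

/-- Conjugation by a permutation moves the tensor factor in position `i` to position `π i`. -/
theorem permConj_tensor {n : ℕ} (π : Equiv.Perm (Fin n))
    (s : Fin n → Matrix (Fin 2) (Fin 2) ℂ) :
    permConj π (tensor s) = tensor (s ∘ π.symm) := by
  ext a b
  simp only [permConj, tensor, Matrix.submatrix_apply, Matrix.of_apply, Function.comp]
  exact Fintype.prod_equiv π _ _ (fun i => by simp)

/-- The symmetrization `𝒞(A) = ∑_{P ∈ C_n} P A Pᵀ` over the cyclic group of order `n`
generated by the translation of the chain. -/
def symmetrize {n : ℕ} (A : Op n) : Op n :=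
  ∑ k ∈ Finset.range n, permConj (finRotate n ^ k) A

/-- The tensor product `σ ⊗ σ_x^{⊗ j} ⊗ τ ⊗ 1^{⊗ (n - j - 2)}` (for `j ≤ n - 2`). -/
def bond (n : ℕ) (σ τ : Matrix (Fin 2) (Fin 2) ℂ) (j : ℕ) : Op n :=
  tensor fun i =>
    if (i : ℕ) = 0 then σ else if (i : ℕ) ≤ j then sigmaX else if (i : ℕ) = j + 1 then τ else 1

/-- `𝐘^j = i 𝒞(σ_y ⊗ σ_x^{⊗ j} ⊗ σ_y ⊗ 1^{⊗ (n - j - 2)})`. -/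
def bY (n j : ℕ) : Op n := Complex.I • symmetrize (bond n sigmaY sigmaY j)

/-- `𝐙^j = i 𝒞(σ_z ⊗ σ_x^{⊗ j} ⊗ σ_z ⊗ 1^{⊗ (n - j - 2)})`. -/
def bZ (n j : ℕ) : Op n := Complex.I • symmetrize (bond n sigmaZ sigmaZ j)

/-- `𝐘𝐙^j`, the sum of the two mixed terms. -/
def bYZ (n j : ℕ) : Op n :=
  Complex.I • symmetrize (bond n sigmaZ sigmaY j) + Complex.I • symmetrize (bond n sigmaY sigmaZ j)

/-- `𝐗 = i 𝒞(σ_x ⊗ 1^{⊗ (n - 1)})`. -/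
def bX (n : ℕ) : Op n :=
  Complex.I • symmetrize (tensor fun i : Fin n => if (i : ℕ) = 0 then sigmaX else 1)

/-- `𝐗𝐗 = i 𝒞(σ_x^{⊗ (n - 1)} ⊗ 1)`. -/
def bXX (n : ℕ) : Op n :=
  Complex.I • symmetrize (tensor fun i : Fin n => if (i : ℕ) + 1 < n then sigmaX else 1)

/-- Labels of the `3 (n - 1) + 2` basis elements. -/
inductive Label (n : ℕ) : Type
  | Y (k : Fin (n - 1))
  | Z (k : Fin (n - 1))
  | YZ (k : Fin (n - 1))
  | X
  | XX

/-- The family `𝐘^k, 𝐙^k, 𝐘𝐙^k (k = 0, …, n - 2), 𝐗, 𝐗𝐗`. -/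
def basisFamily (n : ℕ) : Label n → Op n
  | .Y k => bY n k
  | .Z k => bZ n k
  | .YZ k => bYZ n k
  | .X => bX n
  | .XX => bXX n

/-- The first central element: `-𝐗 + ∑_{k odd} (𝐘^k + 𝐙^k)`, plus `𝐗𝐗` if `n` is even. -/
def center1 (n : ℕ) : Op n :=
  (if Odd n then -bX n else -bX n + bXX n)
    + ∑ k ∈ (Finset.range (n - 1)).filter (fun k => Odd k), (bY n k + bZ n k)

/-- The second central element: `∑_{k even} (𝐘^k + 𝐙^k)`, plus `𝐗𝐗` if `n` is odd. -/
def center2 (n : ℕ) : Op n :=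
  (if Odd n then bXX n else 0)
    + ∑ k ∈ (Finset.range (n - 1)).filter (fun k => Even k), (bY n k + bZ n k)

/-- The polynomials `a_k`: `a_0 = 1`, `a_1 = λ`, `a_{k+2} = λ a_{k+1} - a_k`. -/
def a : ℕ → Polynomial ℝ
  | 0 => 1
  | 1 => Polynomial.X
  | k + 2 => Polynomial.X * a (k + 1) - a k

/-- The `k × k` tridiagonal matrix with `1` directly above and below the diagonal and `0`
everywhere else. -/
def A (k : ℕ) : Matrix (Fin k) (Fin k) ℝ :=
  Matrix.of fun i j => if (i : ℕ) + 1 = j ∨ (j : ℕ) + 1 = i then 1 else 0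

/-- The real roots of `a_{n-1}`. -/
abbrev Root (n : ℕ) : Type := {x : ℝ // (a (n - 1)).IsRoot x}

/-- `X̂_x` (for `n ≥ 3`). -/
def hatX (n : ℕ) (x : ℝ) : Op n :=
  (a 0).eval x • (bX n + bZ n 1) + (a (n - 2)).eval x • (bXX n - bY n (n - 3))
    + ∑ k ∈ Finset.Icc 1 (n - 3), (a k).eval x • (bZ n (k + 1) - bY n (k - 1))

/-- `Ŷ_x = ∑_{k=0}^{n-2} a_k(x) (𝐘^k - 𝐙^k)`. -/
def hatY (n : ℕ) (x : ℝ) : Op n :=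
  ∑ k ∈ Finset.range (n - 1), (a k).eval x • (bY n k - bZ n k)

/-- `Ẑ_x = ∑_{k=0}^{n-2} a_k(x) 𝐘𝐙^k`. -/
def hatZ (n : ℕ) (x : ℝ) : Op n :=
  ∑ k ∈ Finset.range (n - 1), (a k).eval x • bYZ n k

/-- The real Lie algebra `su(2)` of skew-Hermitian traceless complex `2 × 2` matrices. -/
def su2 : LieSubalgebra ℝ (Matrix (Fin 2) (Fin 2) ℂ) where
  carrier := {M | Mᴴ = -M ∧ M.trace = 0}
  zero_mem' := by simp
  add_mem' := by
    rintro M N ⟨hM, hM'⟩ ⟨hN, hN'⟩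
    exact ⟨by rw [Matrix.conjTranspose_add, hM, hN]; abel, by rw [Matrix.trace_add, hM', hN', add_zero]⟩
  smul_mem' := by
    rintro c M ⟨hM, hM'⟩
    exact ⟨by rw [Matrix.conjTranspose_smul, hM]; simp, by rw [Matrix.trace_smul, hM', smul_zero]⟩
  lie_mem' := by
    rintro M N ⟨hM, -⟩ ⟨hN, -⟩
    refine ⟨?_, ?_⟩
    · simp [Ring.lie_def, Matrix.conjTranspose_sub, Matrix.conjTranspose_mul, hM, hN]
    · rw [Ring.lie_def, Matrix.trace_sub, Matrix.trace_mul_comm, sub_self]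

end IsingChain

end

/-!
The local terms of the two Hamiltonians, in the cyclic order `σ_x^0, σ_z^0 σ_z^1, σ_x^1, …`, are
`2 n` involutions `g_b` of which exactly the neighbours anticommute. The sum of the terms of one
parity brackets with a single `g_b` to `2 (g_{b-1} g_b - g_b g_{b+1})` or to `0`, and as a bracket
is a derivation this determines the brackets of `H₀` and `H₁` with all words `g_a g_{a+1} ⋯
g_{a+l-1}`: they lengthen or shorten a word at its ends (`lie_word`). Words of consecutive local
terms are the Pauli strings that define `𝐘^k, 𝐙^k, 𝐘𝐙^k, 𝐗, 𝐗𝐗` up to phases (`word_one_eq`,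
`word_zero_eq`, `word_one_last`). With `P_k = 𝐙^k`, `P_{n-1} = 𝐗𝐗`, `Q_0 = -𝐗`, `Q_{k+1} = 𝐘^k`,
`G_{k+1} = 𝐘𝐙^k` and `G_0 = G_n = 0`, the two generators are `P_0 = i H₀` and `Q_0 = -i H₁`, and
their brackets with the three sequences take the uniform shape `ChainRelations`, part of Onsager's
relations. The family is linearly independent because its members involve Pauli strings with
different numbers of letters `σ_x, σ_y, σ_z` (`linearIndependent_basisFamily`).

The rest is an argument about a Lie algebra `L` generated by two elements `u = Q_0`, `v = P_0`
subject to these relations; only brackets with `u` and `v` are used. Subspaces stable under them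
are ideals, and elements killed by them are central. So the family spans `L`, the two alternating
sums of `P_k` and `Q_k` are central, and for a root `x` of `a_{n-1}` the recursion of the `a_k`
makes `span {X̂_x, Ŷ_x, Ẑ_x}` an ideal. The vectors `(a_0(x), …, a_{n-2}(x))` at the `n - 1` roots
are eigenvectors of `A_{n-1}` for distinct eigenvalues, from which it follows that these ideals
and the two central elements span `L` (`ChainRelations.iSup_summand`). As `dim L = 3 n - 1 = 2 + 3
(n - 1)`, the sum is direct and each summand has its maximal dimension. No nonzero element of the
ideal of a root is killed by `u` and `v`, so the center is spanned by the two central elements.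

Finally, that `⁅u, ·⁆` and `⁅v, ·⁆` are derivations determines the brackets of `X̂_x, Ŷ_x, Ẑ_x` up
to a real factor `c` (`exists_lie_eq`). If `c = 0`, then `Ẑ_x` would be central, contrary to `⁅u,
Ẑ_x⁆ = 4 Ŷ_x`. The roots of `a_{n-1}`, a rescaled Chebyshev polynomial of the second kind, are `2
cos (jπ/n)` with `0 < j < n`, so `x² < 4`, and a rescaling turns the brackets into those of the
cross product, that is, of `su(2)`.
-/

noncomputable section

namespace IsingChain

/-! ### Tensor products of Pauli matrices -/

section
theorem sigmaX_mul_self : sigmaX * sigmaX = 1 := by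
  ext i j; fin_cases i <;> fin_cases j <;> simp [sigmaX, Matrix.mul_apply]

theorem sigmaZ_mul_self : sigmaZ * sigmaZ = 1 := by
  ext i j; fin_cases i <;> fin_cases j <;> simp [sigmaZ, Matrix.mul_apply]

theorem sigmaX_mul_sigmaZ : sigmaX * sigmaZ = Complex.I • sigmaY := by
  ext i j; fin_cases i <;> fin_cases j <;> simp [sigmaX, sigmaY, sigmaZ, Matrix.mul_apply]

theorem sigmaZ_mul_sigmaX : sigmaZ * sigmaX = -Complex.I • sigmaY := by
  ext i j; fin_cases i <;> fin_cases j <;> simp [sigmaX, sigmaY, sigmaZ, Matrix.mul_apply]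

theorem sigmaY_mul_sigmaZ : sigmaY * sigmaZ = -Complex.I • sigmaX := by
  ext i j; fin_cases i <;> fin_cases j <;> simp [sigmaX, sigmaY, sigmaZ, Matrix.mul_apply]

theorem sigmaZ_mul_sigmaX_eq_neg : sigmaZ * sigmaX = -(sigmaX * sigmaZ) := by
  rw [sigmaZ_mul_sigmaX, sigmaX_mul_sigmaZ, neg_smul]

variable {n : ℕ}

theorem tensor_mul (s t : Fin n → Matrix (Fin 2) (Fin 2) ℂ) :
    tensor s * tensor t = tensor (fun i => s i * t i) := by
  ext a b
  simp only [tensor, Matrix.mul_apply, Matrix.of_apply, Finset.prod_univ_sum,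
    Fintype.piFinset_univ, Finset.prod_mul_distrib]

theorem tensor_one : tensor (fun _ : Fin n => 1) = 1 := by
  ext a b
  by_cases h : a = b
  · subst h; simp [tensor]
  · obtain ⟨i, hi⟩ := Function.ne_iff.mp h
    rw [Matrix.one_apply_ne h]
    exact Finset.prod_eq_zero (Finset.mem_univ i) (by simp [Matrix.one_apply_ne hi])

/-- Pulling a scalar out of one tensor factor. -/
theorem tensor_smul_at (s t : Fin n → Matrix (Fin 2) (Fin 2) ℂ) (c : ℂ) (j : Fin n)
    (hj : s j = c • t j) (h : ∀ i, i ≠ j → s i = t i) : tensor s = c • tensor t := by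
  ext a b
  simp only [tensor, Matrix.of_apply, Matrix.smul_apply, smul_eq_mul]
  rw [← Finset.mul_prod_erase _ _ (Finset.mem_univ j),
    ← Finset.mul_prod_erase Finset.univ (fun i => t i (a i) (b i)) (Finset.mem_univ j), hj,
    Matrix.smul_apply, smul_eq_mul, mul_assoc]
  congr 2
  exact Finset.prod_congr rfl fun i hi => by rw [h i (Finset.ne_of_mem_erase hi)]

theorem site_mul_site (σ τ : Matrix (Fin 2) (Fin 2) ℂ) (j : Fin n) :
    site σ j * site τ j = site (σ * τ) j := by
  rw [site, site, site, tensor_mul]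
  congr 1; ext1 i
  by_cases h : i = j
  · subst h; simp
  · simp [h]

theorem site_one (j : Fin n) : site 1 j = 1 := by
  rw [site, ← tensor_one]; congr 1; simp

theorem site_neg (σ : Matrix (Fin 2) (Fin 2) ℂ) (j : Fin n) : site (-σ) j = -site σ j := by
  rw [site, site, ← neg_one_smul ℂ (tensor _)]
  refine tensor_smul_at _ _ _ j (by simp) fun i hi => by simp [hi]

theorem commute_site_site {σ τ : Matrix (Fin 2) (Fin 2) ℂ} {i j : Fin n} (h : i ≠ j) :
    Commute (site σ i) (site τ j) := by
  rw [Commute, SemiconjBy, site, site, tensor_mul, tensor_mul]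
  congr 1; ext1 k
  by_cases hi : k = i
  · subst hi; simp [h]
  · simp [hi]

/-! ### Translations and the symmetrization -/

theorem permConj_mul (π : Equiv.Perm (Fin n)) (A B : Op n) :
    permConj π (A * B) = permConj π A * permConj π B := by
  have e : Function.Bijective (fun a : Fin n → Fin 2 => a ∘ π) :=
    (Equiv.arrowCongr π.symm (Equiv.refl (Fin 2))).bijective
  exact Matrix.submatrix_mul A B _ _ _ e

theorem permConj_permConj (π ρ : Equiv.Perm (Fin n)) (A : Op n) :
    permConj π (permConj ρ A) = permConj (π * ρ) A := rfl

theorem permConj_add (π : Equiv.Perm (Fin n)) (A B : Op n) :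
    permConj π (A + B) = permConj π A + permConj π B := rfl

theorem permConj_sub (π : Equiv.Perm (Fin n)) (A B : Op n) :
    permConj π (A - B) = permConj π A - permConj π B := rfl

theorem permConj_smul {R : Type*} [SMul R ℂ] (π : Equiv.Perm (Fin n)) (c : R) (A : Op n) :
    permConj π (c • A) = c • permConj π A := rfl

theorem permConj_sum {ι : Type*} (π : Equiv.Perm (Fin n)) (s : Finset ι) (f : ι → Op n) :
    permConj π (∑ i ∈ s, f i) = ∑ i ∈ s, permConj π (f i) := by
  ext a b; simp [permConj, Matrix.sum_apply]

theorem permConj_site (π : Equiv.Perm (Fin n)) (σ : Matrix (Fin 2) (Fin 2) ℂ) (j : Fin n) :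
    permConj π (site σ j) = site σ (π j) := by
  rw [site, site, permConj_tensor]
  congr 1; ext1 i
  by_cases h : i = π j
  · subst h; simp
  · rw [Function.update_of_ne h, Function.comp_apply, Function.update_of_ne]
    rintro rfl; simp at h

theorem symmetrize_add (A B : Op n) : symmetrize (A + B) = symmetrize A + symmetrize B := by
  simp [symmetrize, permConj_add, Finset.sum_add_distrib]

theorem symmetrize_sub (A B : Op n) : symmetrize (A - B) = symmetrize A - symmetrize B := by
  simp [symmetrize, permConj_sub, Finset.sum_sub_distrib]

theorem symmetrize_smul (c : ℂ) (A : Op n) : symmetrize (c • A) = c • symmetrize A := by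
  simp [symmetrize, permConj_smul, Finset.smul_sum]

theorem finRotate_pow_card (n : ℕ) : finRotate n ^ n = 1 := by
  rcases n with _ | _ | n
  · rfl
  · ext; simp
  · have h := (isCycle_finRotate (n := n)).orderOf
    rw [support_finRotate, Finset.card_univ, Fintype.card_fin] at h
    have h' := pow_orderOf_eq_one (finRotate (n + 2))
    rwa [h] at h'

theorem symmetrize_permConj (A : Op n) :
    symmetrize (permConj (finRotate n) A) = symmetrize A := by
  simp only [symmetrize, permConj_permConj, ← pow_succ (finRotate n)]
  have h := Finset.sum_range_succ' (fun k => permConj (finRotate n ^ k) A) n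
  rw [Finset.sum_range_succ, finRotate_pow_card, pow_zero] at h
  exact (add_right_cancel h).symm

/-- An operator invariant under translation can be commuted with the symmetrization. -/
theorem lie_symmetrize {E : Op n} (hE : permConj (finRotate n) E = E) (A : Op n) :
    ⁅E, symmetrize A⁆ = symmetrize ⁅E, A⁆ := by
  have hk : ∀ k, permConj (finRotate n ^ k) E = E := by
    intro k
    induction k with
    | zero => rfl
    | succ k ih => rw [pow_succ, ← permConj_permConj, hE, ih]
  simp only [symmetrize, Ring.lie_def, permConj_sub, permConj_mul, hk, Finset.mul_sum,
    Finset.sum_mul, Finset.sum_sub_distrib]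

theorem permConj_H0 : permConj (finRotate n) (H0 n) = H0 n := by
  simp only [H0, permConj_sum, permConj_mul, permConj_site]
  exact Equiv.sum_comp (finRotate n) fun j => site sigmaZ j * site sigmaZ (finRotate n j)

theorem permConj_H1 : permConj (finRotate n) (H1 n) = H1 n := by
  simp only [H1, permConj_sum, permConj_site]
  exact Equiv.sum_comp (finRotate n) fun j => site sigmaX j

end

/-! ### Words in a ring -/

section
/-- The word `g a * g (a + 1) * ⋯ * g (a + l - 1)`. -/
def word {R : Type*} [Monoid R] (g : ℕ → R) (a : ℕ) : ℕ → R
  | 0 => 1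
  | l + 1 => word g a l * g (a + l)

theorem word_succ_left {R : Type*} [Monoid R] (g : ℕ → R) (a l : ℕ) :
    word g a (l + 1) = g a * word g (a + 1) l := by
  induction l with
  | zero => simp [word]
  | succ l ih =>
    rw [word, ih, word, mul_assoc, show a + 1 + l = a + (l + 1) by ring]

theorem lie_mul_eq {R : Type*} [Ring R] (E A B : R) : ⁅E, A * B⁆ = ⁅E, A⁆ * B + A * ⁅E, B⁆ := by
  simp only [Ring.lie_def]; noncomm_ring

/-- The bracket of a word with a sum `E` of generators of one parity, known only through its
brackets with single generators: `E` lengthens or shortens the word by one letter at either end,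
and the parities decide which. By induction on the length, since `⁅E, ·⁆` is a derivation; no
relation between distant generators enters, so words of every length are covered, including those
that wrap around the chain. -/
theorem lie_word {R : Type*} [Ring R] (g : ℕ → R) (hg : ∀ b, g b * g b = 1) (E : R) (q : ℕ)
    (h₀ : ∀ b, Even (b + q) → ⁅E, g b⁆ = 0)
    (h₁ : ∀ b, Even (b + q) → ⁅E, g (b + 1)⁆ = 2 * (g b * g (b + 1) - g (b + 1) * g (b + 2)))
    (a l : ℕ) :
    ⁅E, word g (a + 1) (l + 1)⁆ =
      2 * ((if Even (a + q) then word g a (l + 2) else word g (a + 2) l)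
        - (if Even (a + l + q) then word g (a + 1) (l + 2) else word g (a + 1) l)) := by
  induction l with
  | zero =>
    have e1 : word g (a + 1) 1 = g (a + 1) := by simp [word]
    rw [zero_add, e1]
    by_cases h : Even (a + q)
    · rw [h₁ a h]
      simp [h, word]
    · rw [h₀ (a + 1) (by grind)]
      simp [h, word]
  | succ l ih =>
    have hL : (if Even (a + q) then word g a (l + 2) else word g (a + 2) l) * g (a + 1 + (l + 1))
        = if Even (a + q) then word g a (l + 3) else word g (a + 2) (l + 1) := by
      split_ifs
      · rw [word.eq_2 g a (l + 2)]; congr 2; ring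
      · rw [word.eq_2 g (a + 2) l]; congr 2; ring
    rw [word, lie_mul_eq, ih, mul_assoc, sub_mul, hL]
    by_cases h : Even (a + l + q)
    · have h' : ¬ Even (a + (l + 1) + q) := by grind
      rw [if_pos h, if_neg h', h₀ (a + 1 + (l + 1)) (by grind), mul_zero, add_zero,
        word.eq_2 g (a + 1) (l + 1), mul_assoc (word g (a + 1) (l + 1)), hg, mul_one]
    · have h' : Even (a + (l + 1) + q) := by grind
      have e := h₁ (a + 1 + l) (by grind)
      rw [if_neg h, if_pos h', show a + 1 + (l + 1) = a + 1 + l + 1 by ring, e,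
        word.eq_2 g (a + 1) (l + 2), word.eq_2 g (a + 1) (l + 1), word.eq_2 g (a + 1) l,
        show a + 1 + (l + 1) = a + 1 + l + 1 by ring, show a + 1 + (l + 2) = a + 1 + l + 2 by ring]
      generalize word g (a + 1) l = w
      generalize (if Even (a + q) then word g a (l + 1 + 2) else word g (a + 2) (l + 1)) = v
      have e2 : w * g (a + 1 + l) * (2 * (g (a + 1 + l) * g (a + 1 + l + 1)
          - g (a + 1 + l + 1) * g (a + 1 + l + 2))) =
          2 * (w * (g (a + 1 + l) * g (a + 1 + l)) * g (a + 1 + l + 1)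
          - w * g (a + 1 + l) * g (a + 1 + l + 1) * g (a + 1 + l + 2)) := by noncomm_ring
      rw [e2, hg]
      noncomm_ring

variable {n : ℕ}

/-! ### The local terms of the two Hamiltonians -/

/-- The site of the chain at the position `j`, read modulo the length `n`. -/
def pos (n : ℕ) [NeZero n] (j : ℕ) : Fin n := Fin.ofNat n j

theorem finRotate_pos (n : ℕ) [NeZero n] (j : ℕ) : finRotate n (pos n j) = pos n (j + 1) := by
  rw [finRotate_apply]
  ext; simp [pos, Fin.val_add]

/-- The local terms of the two Hamiltonians in their cyclic order: `σ_x^j` at the even index `2 j`,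
and `σ_z^j σ_z^{j+1}` at the odd index `2 j + 1`. Each squares to `1`, neighbours anticommute, and
the others commute. -/
def chainGen (n : ℕ) [NeZero n] (b : ℕ) : Op n :=
  if Even b then site sigmaX (pos n (b / 2))
  else site sigmaZ (pos n (b / 2)) * site sigmaZ (pos n (b / 2 + 1))

theorem chainGen_even (n : ℕ) [NeZero n] (j : ℕ) : chainGen n (2 * j) = site sigmaX (pos n j) := by
  simp [chainGen]

theorem chainGen_odd (n : ℕ) [NeZero n] (j : ℕ) :
    chainGen n (2 * j + 1) = site sigmaZ (pos n j) * site sigmaZ (pos n (j + 1)) := by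
  rw [chainGen, if_neg (by simp), show (2 * j + 1) / 2 = j by omega]

theorem pos_succ_ne (hn : 2 ≤ n) [NeZero n] (j : ℕ) : pos n j ≠ pos n (j + 1) := by
  intro h
  have := congrArg Fin.val h
  simp only [pos, Fin.val_ofNat] at this
  have h1 : (j + 1) % n = j % n := this.symm
  have : j + 1 ≡ j + 0 [MOD n] := h1
  have := Nat.ModEq.add_left_cancel' j this
  rw [Nat.modEq_zero_iff_dvd] at this
  have := Nat.le_of_dvd one_pos this
  omega

theorem chainGen_mul_self (hn : 2 ≤ n) [NeZero n] (b : ℕ) : chainGen n b * chainGen n b = 1 := by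
  obtain ⟨j, rfl | rfl⟩ := Nat.even_or_odd' b
  · rw [chainGen_even, site_mul_site, sigmaX_mul_self, site_one]
  · rw [chainGen_odd, (commute_site_site (pos_succ_ne hn j).symm).mul_mul_mul_comm, site_mul_site,
      site_mul_site, sigmaZ_mul_self, site_one, site_one, one_mul]

theorem permConj_chainGen (n : ℕ) [NeZero n] (b : ℕ) :
    permConj (finRotate n) (chainGen n b) = chainGen n (b + 2) := by
  obtain ⟨j, rfl | rfl⟩ := Nat.even_or_odd' b
  · rw [show 2 * j + 2 = 2 * (j + 1) by ring, chainGen_even, chainGen_even, permConj_site,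
      finRotate_pos]
  · rw [show 2 * j + 1 + 2 = 2 * (j + 1) + 1 by ring, chainGen_odd, chainGen_odd, permConj_mul,
      permConj_site, permConj_site, finRotate_pos, finRotate_pos]

theorem site_sigmaZ_mul_sigmaX (j : Fin n) :
    site sigmaZ j * site sigmaX j = -(site sigmaX j * site sigmaZ j) := by
  rw [site_mul_site, site_mul_site, sigmaZ_mul_sigmaX_eq_neg, site_neg]

theorem lie_H1_site (j : Fin n) (σ : Matrix (Fin 2) (Fin 2) ℂ) :
    ⁅H1 n, site σ j⁆ = ⁅site sigmaX j, site σ j⁆ := by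
  rw [H1, Ring.lie_def, Finset.sum_mul, Finset.mul_sum, ← Finset.sum_sub_distrib,
    Finset.sum_eq_single j]
  · rfl
  · intro i _ hi
    rw [(commute_site_site hi).eq, sub_self]
  · simp

theorem lie_H0_site_sigmaZ (j : Fin n) : ⁅H0 n, site sigmaZ j⁆ = 0 := by
  rw [H0, Ring.lie_def, Finset.sum_mul, Finset.mul_sum, ← Finset.sum_sub_distrib]
  refine Finset.sum_eq_zero fun i _ => ?_
  have h : ∀ i, Commute (site sigmaZ i) (site sigmaZ j) := fun i => by
    by_cases h : i = j
    · rw [h]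
    · exact commute_site_site h
  rw [((h i).mul_left (h _)).eq, sub_self]

theorem lie_H1_chainGen_even [NeZero n] (j : ℕ) : ⁅H1 n, chainGen n (2 * j)⁆ = 0 := by
  rw [chainGen_even, lie_H1_site, lie_self]

theorem lie_H0_chainGen_odd [NeZero n] (j : ℕ) : ⁅H0 n, chainGen n (2 * j + 1)⁆ = 0 := by
  rw [chainGen_odd, lie_mul_eq, lie_H0_site_sigmaZ, lie_H0_site_sigmaZ, zero_mul, mul_zero,
    add_zero]

theorem lie_H1_chainGen_odd [NeZero n] (j : ℕ) :
    ⁅H1 n, chainGen n (2 * j + 1)⁆ =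
      2 * (chainGen n (2 * j) * chainGen n (2 * j + 1) -
        chainGen n (2 * j + 1) * chainGen n (2 * j + 2)) := by
  rw [show 2 * j + 2 = 2 * (j + 1) by ring, chainGen_even, chainGen_even, chainGen_odd, lie_mul_eq,
    lie_H1_site, lie_H1_site, Ring.lie_def, Ring.lie_def, site_sigmaZ_mul_sigmaX]
  have h := site_sigmaZ_mul_sigmaX (pos n (j + 1))
  have h' : site sigmaX (pos n (j + 1)) * site sigmaZ (pos n (j + 1)) =
    -(site sigmaZ (pos n (j + 1)) * site sigmaX (pos n (j + 1))) := by rw [h, neg_neg]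
  rw [h']
  noncomm_ring

theorem lie_H0_chainGen_even (hn : 3 ≤ n) [NeZero n] (j : ℕ) :
    ⁅H0 n, chainGen n (2 * j + 2)⁆ =
      2 * (chainGen n (2 * j + 1) * chainGen n (2 * j + 2) -
        chainGen n (2 * j + 2) * chainGen n (2 * j + 3)) := by
  rw [show 2 * j + 3 = 2 * (j + 1) + 1 by ring, show 2 * j + 2 = 2 * (j + 1) by ring, chainGen_even,
    chainGen_odd, chainGen_odd]
  have h1 : pos n j ≠ pos n (j + 1) := pos_succ_ne (by omega) j
  have h2 : pos n (j + 1) ≠ pos n (j + 1 + 1) := pos_succ_ne (by omega) (j + 1)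
  have hX := site_sigmaZ_mul_sigmaX (pos n (j + 1))
  rw [H0, Ring.lie_def, Finset.sum_mul, Finset.mul_sum, ← Finset.sum_sub_distrib,
    ← Finset.sum_subset (Finset.subset_univ {pos n j, pos n (j + 1)}),
    Finset.sum_pair h1, finRotate_pos, finRotate_pos]
  · have c1 := (commute_site_site (σ := sigmaX) (τ := sigmaZ) h1.symm).eq
    have c2 := (commute_site_site (σ := sigmaX) (τ := sigmaZ) h2).eq
    rw [← mul_assoc (site sigmaX _) (site sigmaZ (pos n j)), c1,
      mul_assoc (site sigmaZ (pos n j)), mul_assoc (site sigmaZ (pos n j)), hX,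
      mul_assoc (site sigmaZ (pos n (j + 1))), ← c2, ← mul_assoc (site sigmaZ (pos n (j + 1))), hX]
    noncomm_ring
  · intro i _ hi
    simp only [Finset.mem_insert, Finset.mem_singleton, not_or] at hi
    have hr : finRotate n i ≠ pos n (j + 1) := by
      rw [← finRotate_pos]; exact fun h => hi.1 ((finRotate n).injective h)
    rw [((commute_site_site hi.2).mul_left (commute_site_site hr)).eq, sub_self]

/-- The symmetrization of the word of length `l` in the local terms that starts at index `p`. -/
def symWord (n : ℕ) [NeZero n] (p l : ℕ) : Op n := symmetrize (word (chainGen n) p l)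

theorem symWord_add_two [NeZero n] (p l : ℕ) : symWord n (p + 2) l = symWord n p l := by
  rw [symWord, symWord, ← symmetrize_permConj (word (chainGen n) p l)]
  congr 1
  induction l with
  | zero =>
    rw [word, word, ← tensor_one, permConj_tensor]; rfl
  | succ l ih =>
    rw [word, word, permConj_mul, permConj_chainGen, ih, add_right_comm]

theorem symmetrize_two_mul (A : Op n) : symmetrize (2 * A) = 2 * symmetrize A := by
  rw [two_mul, two_mul, symmetrize_add]

/-- `⁅H₁, ·⁆` and `⁅H₀, ·⁆` on symmetrized words. The first index is a successor so that a word can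
be extended to the left. -/
theorem lie_symWord [NeZero n] (hn : 3 ≤ n) (a l : ℕ) :
    (⁅H1 n, symWord n (a + 1) (l + 1)⁆ =
      2 * ((if Even a then symWord n a (l + 2) else symWord n a l)
        - (if Even (a + l) then symWord n (a + 1) (l + 2) else symWord n (a + 1) l))) ∧
    (⁅H0 n, symWord n (a + 1) (l + 1)⁆ =
      2 * ((if Even a then symWord n a l else symWord n a (l + 2))
        - (if Even (a + l) then symWord n (a + 1) l else symWord n (a + 1) (l + 2)))) := by
  constructor
  · rw [symWord, lie_symmetrize permConj_H1,
      lie_word (chainGen n) (chainGen_mul_self (by omega)) (H1 n) 0,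
      symmetrize_two_mul, symmetrize_sub]
    · rw [add_zero, add_zero, ← symWord_add_two a l]
      split_ifs <;> rfl
    · intro b hb
      obtain ⟨j, rfl⟩ := even_iff_two_dvd.mp hb
      exact lie_H1_chainGen_even j
    · intro b hb
      obtain ⟨j, rfl⟩ := even_iff_two_dvd.mp hb
      exact lie_H1_chainGen_odd j
  · rw [symWord, lie_symmetrize permConj_H0,
      lie_word (chainGen n) (chainGen_mul_self (by omega)) (H0 n) 1,
      symmetrize_two_mul, symmetrize_sub]
    · rw [← symWord_add_two a l]
      by_cases h1 : Even a <;> by_cases h2 : Even (a + l) <;>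
        simp [h1, h2, Nat.even_add_one] <;> rfl
    · intro b hb
      obtain ⟨j, rfl⟩ : Odd b := by grind
      exact lie_H0_chainGen_odd j
    · intro b hb
      obtain ⟨j, rfl⟩ : Odd b := by grind
      exact lie_H0_chainGen_even hn j

end

section
variable {n : ℕ} [NeZero n]

theorem val_pos_of_lt {j : ℕ} (hj : j < n) : (pos n j : ℕ) = j := by
  simp [pos, Nat.mod_eq_of_lt hj]

/-! ### Words as Pauli strings -/

theorem bond_mul_sigmaX (σ τ τ' : Matrix (Fin 2) (Fin 2) ℂ) (c : ℂ) (h : τ * sigmaX = c • τ')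
    {k : ℕ} (hk : k + 1 < n) :
    bond n σ τ k * site sigmaX (pos n (k + 1)) = c • bond n σ τ' k := by
  rw [bond, bond, site, tensor_mul]
  have hp := val_pos_of_lt hk
  refine tensor_smul_at _ _ _ (pos n (k + 1)) (by simp [hp, h]) fun i hi => ?_
  have hi' : (i : ℕ) ≠ k + 1 := fun e => hi (Fin.ext (by rw [e, hp]))
  simp [hi, hi']

theorem bond_mul_sigmaZ (σ : Matrix (Fin 2) (Fin 2) ℂ) {k : ℕ} (hk : k + 2 < n) :
    bond n σ sigmaY k * (site sigmaZ (pos n (k + 1)) * site sigmaZ (pos n (k + 2))) =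
      -Complex.I • bond n σ sigmaZ (k + 1) := by
  rw [bond, bond, site, site, tensor_mul, tensor_mul]
  have hp := val_pos_of_lt (show k + 1 < n by omega)
  have hp2 := val_pos_of_lt hk
  have hne : pos n (k + 1) ≠ pos n (k + 2) := fun e => by
    have := congrArg Fin.val e; omega
  refine tensor_smul_at _ _ _ (pos n (k + 1)) (by simp [hp, hne, sigmaY_mul_sigmaZ]) fun i hi => ?_
  have hi' : (i : ℕ) ≠ k + 1 := fun e => hi (Fin.ext (by rw [e, hp]))
  by_cases h2 : i = pos n (k + 2)
  · subst h2; simp [hi, hp2]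
  · have h2' : (i : ℕ) ≠ k + 2 := fun e => h2 (Fin.ext (by rw [e, hp2]))
    simp only [Function.update_of_ne hi, Function.update_of_ne h2, mul_one]
    grind

/-- Words that start at a `σ_z σ_z` term, up to the length at which they cover the chain. -/
theorem word_one_eq (hn : 3 ≤ n) (k : ℕ) (hk : k + 1 < n) :
    word (chainGen n) 1 (2 * k + 1) = (-1 : ℂ) ^ k • bond n sigmaZ sigmaZ k ∧
    word (chainGen n) 1 (2 * k + 2) = (-Complex.I * (-1) ^ k) • bond n sigmaZ sigmaY k := by
  have step : ∀ k, k + 1 < n →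
      word (chainGen n) 1 (2 * k + 1) = (-1 : ℂ) ^ k • bond n sigmaZ sigmaZ k →
      word (chainGen n) 1 (2 * k + 2) = (-Complex.I * (-1) ^ k) • bond n sigmaZ sigmaY k := by
    intro k hk h
    rw [word, h, show 1 + (2 * k + 1) = 2 * (k + 1) by ring, chainGen_even, smul_mul_assoc,
      bond_mul_sigmaX _ _ _ _ sigmaZ_mul_sigmaX hk, smul_smul]
    congr 1; ring
  induction k with
  | zero =>
    have h : word (chainGen n) 1 (2 * 0 + 1) = (-1 : ℂ) ^ 0 • bond n sigmaZ sigmaZ 0 := by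
      rw [word, word, one_mul, pow_zero, one_smul, show 1 + 2 * 0 = 2 * 0 + 1 by rfl, chainGen_odd,
        site, site, tensor_mul, bond]
      congr 1; ext1 i
      have h0 := val_pos_of_lt (show 0 < n by omega)
      have h1 := val_pos_of_lt (show 1 < n by omega)
      simp only [Function.update_apply, Fin.ext_iff, h0, zero_add, h1]
      split_ifs <;> first | omega | simp
    exact ⟨h, step 0 hk h⟩
  | succ k ih =>
    have h : word (chainGen n) 1 (2 * (k + 1) + 1) =
        (-1 : ℂ) ^ (k + 1) • bond n sigmaZ sigmaZ (k + 1) := by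
      rw [word, show 2 * (k + 1) = 2 * k + 2 by ring, (ih (by omega)).2,
        show 1 + (2 * k + 2) = 2 * (k + 1) + 1 by ring, chainGen_odd, smul_mul_assoc,
        bond_mul_sigmaZ _ (by omega), smul_smul]
      congr 1; linear_combination (-1 : ℂ) ^ k * Complex.I_mul_I
    exact ⟨h, step _ hk h⟩

/-- Words that start at a `σ_x` term, up to the length at which they cover the chain. -/
theorem word_zero_eq (hn : 3 ≤ n) (k : ℕ) (hk : k + 1 < n) :
    word (chainGen n) 0 (2 * k + 2) = (Complex.I * (-1 : ℂ) ^ k) • bond n sigmaY sigmaZ k ∧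
    word (chainGen n) 0 (2 * k + 3) = (-1 : ℂ) ^ k • bond n sigmaY sigmaY k := by
  have step : ∀ k, k + 1 < n →
      word (chainGen n) 0 (2 * k + 2) = (Complex.I * (-1 : ℂ) ^ k) • bond n sigmaY sigmaZ k →
      word (chainGen n) 0 (2 * k + 3) = (-1 : ℂ) ^ k • bond n sigmaY sigmaY k := by
    intro k hk h
    rw [word, h, show 0 + (2 * k + 2) = 2 * (k + 1) by ring, chainGen_even, smul_mul_assoc,
      bond_mul_sigmaX _ _ _ _ sigmaZ_mul_sigmaX hk, smul_smul]
    congr 1; linear_combination -(-1 : ℂ) ^ k * Complex.I_mul_I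
  induction k with
  | zero =>
    have h : word (chainGen n) 0 (2 * 0 + 2) =
        (Complex.I * (-1 : ℂ) ^ 0) • bond n sigmaY sigmaZ 0 := by
      rw [word, word, word, one_mul, pow_zero, mul_one, show 0 + (2 * 0 + 1) = 2 * 0 + 1 by rfl,
        chainGen_odd, show 0 + 2 * 0 = 2 * 0 by rfl, chainGen_even, ← mul_assoc, site_mul_site,
        sigmaX_mul_sigmaZ, site, site, tensor_mul, bond]
      have h0 := val_pos_of_lt (show 0 < n by omega)
      have h1 := val_pos_of_lt (show 1 < n by omega)
      have h01 : pos n 0 ≠ pos n 1 := pos_succ_ne (by omega) 0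
      refine tensor_smul_at _ _ _ (pos n 0) (by simp [h0, h01]) fun i hi => ?_
      rw [Ne, Fin.ext_iff, h0] at hi
      simp only [Function.update_apply, Fin.ext_iff, h0, zero_add, h1]
      split_ifs <;> first | omega | simp
    exact ⟨h, step 0 hk h⟩
  | succ k ih =>
    have h : word (chainGen n) 0 (2 * (k + 1) + 2) =
        (Complex.I * (-1 : ℂ) ^ (k + 1)) • bond n sigmaY sigmaZ (k + 1) := by
      rw [word, show 2 * (k + 1) + 1 = 2 * k + 3 by ring, (ih (by omega)).2,
        show 0 + (2 * k + 3) = 2 * (k + 1) + 1 by ring, chainGen_odd, smul_mul_assoc,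
        bond_mul_sigmaZ _ (by omega), smul_smul]
      congr 1; ring
    exact ⟨h, step _ hk h⟩

/-- The product of all local terms but `σ_x^0`, in cyclic order from index `1`: the last factor
closes the chain, and the `σ_z` at site `0` cancels. -/
theorem word_one_last (hn : 3 ≤ n) :
    word (chainGen n) 1 (2 * (n - 1) + 1) =
      (-1 : ℂ) ^ (n - 1) • tensor fun i : Fin n => if (i : ℕ) = 0 then 1 else sigmaX := by
  obtain ⟨k, rfl⟩ : ∃ k, n = k + 2 := ⟨n - 2, by omega⟩
  rw [word, show 2 * (k + 2 - 1) = 2 * k + 2 by omega, (word_one_eq hn k (by omega)).2,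
    show 1 + (2 * k + 2) = 2 * (k + 1) + 1 by ring, chainGen_odd, smul_mul_assoc]
  have hp : pos (k + 2) (k + 1 + 1) = pos (k + 2) 0 := by ext; simp [pos]
  have h : bond (k + 2) sigmaZ sigmaY k * (site sigmaZ (pos (k + 2) (k + 1)) *
      site sigmaZ (pos (k + 2) 0)) =
      -Complex.I • tensor fun i : Fin (k + 2) => if (i : ℕ) = 0 then 1 else sigmaX := by
    rw [bond, site, site, tensor_mul, tensor_mul]
    have h0 := val_pos_of_lt (show 0 < k + 2 by omega)
    have h1 := val_pos_of_lt (show k + 1 < k + 2 by omega)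
    refine tensor_smul_at _ _ _ (pos _ (k + 1)) ?_ fun i hi => ?_
    · simp [Fin.ext_iff, h0, h1, sigmaY_mul_sigmaZ]
    · rw [Ne, Fin.ext_iff, h1] at hi
      have := i.isLt
      simp only [Function.update_apply, Fin.ext_iff, h0, h1]
      split_ifs <;> first | omega | simp [sigmaZ_mul_self]
  rw [hp, h, smul_smul]
  congr 1
  rw [show k + 2 - 1 = k + 1 by omega]
  linear_combination (-1 : ℂ) ^ k * Complex.I_mul_I

/-! ### The three families of operators -/

/-- The operators `𝐙^0, …, 𝐙^{n-2}, 𝐗𝐗`, as symmetrized words with phases. The definition makes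
sense for all `k`, and the bracket relations hold for all `k`. -/
def opP (n : ℕ) [NeZero n] (k : ℕ) : Op n := (Complex.I * (-1) ^ k) • symWord n 1 (2 * k + 1)

/-- The operators `-𝐗, 𝐘^0, …, 𝐘^{n-2}`, as symmetrized words with phases. -/
def opQ (n : ℕ) [NeZero n] (k : ℕ) : Op n := (-Complex.I * (-1) ^ k) • symWord n 0 (2 * k + 1)

/-- The operators `0, 𝐘𝐙^0, …, 𝐘𝐙^{n-2}, 0`, as differences of symmetrized words. -/
def opG (n : ℕ) [NeZero n] (k : ℕ) : Op n :=
  ((-1 : ℂ) ^ k) • (symWord n 1 (2 * k) - symWord n 0 (2 * k))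

theorem neg_one_pow_mul_self (k : ℕ) : (-1 : ℂ) ^ k * (-1) ^ k = 1 := by
  rw [← mul_pow]; norm_num

theorem opP_of_lt (hn : 3 ≤ n) {k : ℕ} (hk : k + 1 < n) : opP n k = bZ n k := by
  rw [opP, symWord, (word_one_eq hn k hk).1, symmetrize_smul, smul_smul, mul_assoc,
    neg_one_pow_mul_self, mul_one, bZ]

theorem opP_last (hn : 3 ≤ n) : opP n (n - 1) = bXX n := by
  rw [opP, symWord, word_one_last hn, symmetrize_smul, smul_smul, mul_assoc,
    neg_one_pow_mul_self, mul_one, bXX]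
  congr 1
  rw [← symmetrize_permConj (tensor fun i : Fin n => if (i : ℕ) + 1 < n then sigmaX else 1),
    permConj_tensor]
  congr 2; ext1 i
  obtain ⟨j, rfl⟩ := (finRotate n).surjective i
  have : ((finRotate n j : Fin n) : ℕ) = if (j : ℕ) + 1 < n then (j : ℕ) + 1 else 0 := by
    rw [finRotate_apply, Fin.val_add]
    have := j.isLt
    have h1 : ((1 : Fin n) : ℕ) = 1 := by rw [Fin.val_one', Nat.mod_eq_of_lt (by omega)]
    rw [h1]
    split_ifs with h
    · exact Nat.mod_eq_of_lt h
    · rw [show (j : ℕ) + 1 = n by omega, Nat.mod_self]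
  rw [this, Function.comp_apply, Equiv.symm_apply_apply]
  by_cases h : (j : ℕ) + 1 < n <;> simp [h]

theorem opQ_zero (hn : 3 ≤ n) : opQ n 0 = -bX n := by
  have h : site sigmaX (pos n 0) = tensor fun i : Fin n => if (i : ℕ) = 0 then sigmaX else 1 := by
    rw [site]
    congr 1; ext1 i
    simp only [Function.update_apply, Fin.ext_iff, val_pos_of_lt (show 0 < n by omega)]
  rw [opQ, symWord, show 2 * 0 + 1 = 0 + 1 by rfl, word, word, one_mul, show 0 + 0 = 2 * 0 by rfl,
    chainGen_even, h, bX, pow_zero, mul_one, neg_smul]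

theorem opQ_succ (hn : 3 ≤ n) {k : ℕ} (hk : k + 1 < n) : opQ n (k + 1) = bY n k := by
  rw [opQ, symWord, show 2 * (k + 1) + 1 = 2 * k + 3 by ring, (word_zero_eq hn k hk).2,
    symmetrize_smul, smul_smul, bY]
  congr 1
  linear_combination Complex.I * neg_one_pow_mul_self k

theorem opG_succ (hn : 3 ≤ n) {k : ℕ} (hk : k + 1 < n) : opG n (k + 1) = bYZ n k := by
  rw [opG, symWord, symWord, show 2 * (k + 1) = 2 * k + 2 by ring, (word_zero_eq hn k hk).1,
    (word_one_eq hn k hk).2, symmetrize_smul, symmetrize_smul, smul_sub, smul_smul, smul_smul, bYZ,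
    sub_eq_add_neg, ← neg_smul]
  congr 2 <;> linear_combination Complex.I * neg_one_pow_mul_self k

theorem opG_zero : opG n 0 = 0 := by
  rw [opG, symWord, symWord]; simp [word]

/-- The two words that run once around the chain agree, so the family of the `𝐘𝐙^k` ends with
`0`. -/
theorem opG_last (hn : 3 ≤ n) : opG n n = 0 := by
  have h : symWord n 1 (2 * n) = symWord n 0 (2 * n) := by
    obtain ⟨k, hk⟩ : ∃ k, n = k + 1 := ⟨n - 1, by omega⟩
    have e : 2 * n = 2 * (n - 1) + 1 + 1 := by omega
    rw [symWord, symWord, e, word_succ_left _ 0, word, zero_add, word_one_last hn,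
      show 1 + (2 * (n - 1) + 1) = 2 * n by omega, chainGen_even, show (0 : ℕ) = 2 * 0 by rfl,
      chainGen_even,
      show pos n n = pos n 0 by ext; simp [pos], smul_mul_assoc, mul_smul_comm, site, tensor_mul,
      tensor_mul]
    congr 3; ext1 i
    have h0 := val_pos_of_lt (show 0 < n by omega)
    simp only [Function.update_apply, Fin.ext_iff, h0, mul_zero]
    split_ifs <;> simp
  rw [opG, h, sub_self, smul_zero]

/-- The symmetrization of one member of a translation covariant family is the sum of the family. -/
theorem symmetrize_eq_sum (f : Fin n → Op n)
    (hf : ∀ j, permConj (finRotate n) (f j) = f (finRotate n j)) :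
    symmetrize (f (pos n 0)) = ∑ j, f j := by
  have hk : ∀ k, permConj (finRotate n ^ k) (f (pos n 0)) = f (pos n k) := by
    intro k
    induction k with
    | zero => rfl
    | succ k ih => rw [pow_succ', ← permConj_permConj, ih, hf, finRotate_pos]
  simp only [symmetrize, hk]
  rw [Finset.sum_range]
  exact Finset.sum_congr rfl fun i _ => congrArg f (Fin.ext (val_pos_of_lt i.isLt))

theorem symWord_zero_one : symWord n 0 1 = H1 n := by
  rw [H1, ← symmetrize_eq_sum (fun j => site sigmaX j) fun j => permConj_site _ _ _, symWord, word,
    word, one_mul, show 0 + 0 = 2 * 0 by rfl, chainGen_even]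

theorem symWord_one_one : symWord n 1 1 = H0 n := by
  rw [H0, ← symmetrize_eq_sum (fun j => site sigmaZ j * site sigmaZ (finRotate n j)) fun j => by
    rw [permConj_mul, permConj_site, permConj_site], symWord, word,
    word, one_mul, show 1 + 0 = 2 * 0 + 1 by rfl, chainGen_odd, finRotate_pos]

theorem opP_zero : opP n 0 = Complex.I • H0 n := by
  rw [opP, pow_zero, mul_one, ← symWord_one_one]

theorem opQ_zero_eq_H1 : opQ n 0 = -(Complex.I • H1 n) := by
  rw [opQ, pow_zero, mul_one, ← symWord_zero_one, neg_smul]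

theorem lie_opQ_zero_opP (hn : 3 ≤ n) (k : ℕ) : ⁅opQ n 0, opP n k⁆ = (2 : ℝ) • opG n (k + 1) := by
  have h := (lie_symWord hn 0 (2 * k)).1
  simp only [zero_add, even_two_mul, Even.zero, if_true] at h
  rw [opQ_zero_eq_H1, opP, neg_lie, smul_lie, lie_smul, h, opG, pow_succ, mul_add 2 k 1]
  simp only [two_mul, two_smul, ← smul_add, smul_smul, ← neg_smul, mul_one]
  rw [show -(Complex.I * (Complex.I * (-1) ^ k)) = (-1 : ℂ) ^ k by
    linear_combination -(-1 : ℂ) ^ k * Complex.I_mul_I]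
  module

theorem lie_opP_zero_opP (hn : 3 ≤ n) (k : ℕ) : ⁅opP n 0, opP n k⁆ = (2 : ℝ) • opG n k := by
  have h := (lie_symWord hn 0 (2 * k)).2
  simp only [zero_add, even_two_mul, Even.zero, if_true] at h
  rw [opP_zero, opP, smul_lie, lie_smul, h, opG]
  simp only [two_mul, two_smul, ← smul_add, smul_smul]
  rw [show Complex.I * (Complex.I * (-1) ^ k) = -(-1 : ℂ) ^ k by
    linear_combination (-1 : ℂ) ^ k * Complex.I_mul_I]
  module

theorem lie_opQ_zero_opQ (hn : 3 ≤ n) (k : ℕ) : ⁅opQ n 0, opQ n k⁆ = (-2 : ℝ) • opG n k := by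
  have h := (lie_symWord hn 1 (2 * k)).1
  simp only [show ¬ Even 1 by decide, show ¬ Even (1 + 2 * k) by simp [Nat.even_add], if_false,
    symWord_add_two 0] at h
  rw [opQ_zero_eq_H1, opQ, neg_lie, smul_lie, lie_smul, h, opG]
  simp only [two_mul, neg_smul, two_smul, ← smul_add, smul_smul]
  rw [show Complex.I * (-Complex.I * (-1) ^ k) = (-1 : ℂ) ^ k by
    linear_combination -(-1 : ℂ) ^ k * Complex.I_mul_I]

theorem lie_opP_zero_opQ (hn : 3 ≤ n) (k : ℕ) :
    ⁅opP n 0, opQ n k⁆ = (-2 : ℝ) • opG n (k + 1) := by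
  have h := (lie_symWord hn 1 (2 * k)).2
  simp only [show ¬ Even 1 by decide, show ¬ Even (1 + 2 * k) by simp [Nat.even_add], if_false,
    symWord_add_two 0] at h
  rw [opP_zero, opQ, smul_lie, lie_smul, h, opG, pow_succ, mul_add 2 k 1]
  simp only [two_mul, neg_smul, two_smul, ← smul_add, smul_smul, mul_one]
  rw [show Complex.I * (-Complex.I * (-1) ^ k) = (-1 : ℂ) ^ k by
    linear_combination -(-1 : ℂ) ^ k * Complex.I_mul_I]
  module

theorem lie_opQ_zero_opG (hn : 3 ≤ n) (k : ℕ) :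
    ⁅opQ n 0, opG n (k + 1)⁆ = (4 : ℝ) • (opQ n (k + 1) - opP n k) := by
  have h := (lie_symWord hn 0 (2 * k + 1)).1
  have h' := (lie_symWord hn 1 (2 * k + 1)).1
  simp only [zero_add, Even.zero, show ¬ Even 1 by decide, if_true, if_false,
    show ¬ Even (2 * k + 1) by simp, show Even (1 + (2 * k + 1)) by grind,
    symWord_add_two 0] at h h'
  rw [opQ_zero_eq_H1, opG, neg_lie, smul_lie, lie_smul, lie_sub, mul_add 2 k 1, mul_one,
    h, h', opQ, opP, pow_succ, mul_add 2 k 1, mul_one]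
  simp only [two_mul]
  module

theorem lie_opP_zero_opG (hn : 3 ≤ n) (k : ℕ) :
    ⁅opP n 0, opG n (k + 1)⁆ = (4 : ℝ) • (opQ n k - opP n (k + 1)) := by
  have h := (lie_symWord hn 0 (2 * k + 1)).2
  have h' := (lie_symWord hn 1 (2 * k + 1)).2
  simp only [zero_add, Even.zero, show ¬ Even 1 by decide, if_true, if_false,
    show ¬ Even (2 * k + 1) by simp, show Even (1 + (2 * k + 1)) by grind,
    symWord_add_two 0] at h h'
  rw [opP_zero, opG, smul_lie, lie_smul, lie_sub, mul_add 2 k 1, mul_one,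
    h, h', opQ, opP, pow_succ, mul_add 2 k 1, mul_one]
  simp only [two_mul]
  module

end

/-! ### Linear independence -/

section
variable {n : ℕ}

/-- The four Pauli matrices `1, σ_x, σ_y, σ_z`. -/
def pauli : Fin 4 → Matrix (Fin 2) (Fin 2) ℂ := ![1, sigmaX, sigmaY, sigmaZ]

theorem trace_pauli_mul_pauli (p q : Fin 4) :
    (pauli p * pauli q).trace = if p = q then 2 else 0 := by
  fin_cases p <;> fin_cases q <;>
    simp [pauli, sigmaX, sigmaY, sigmaZ, Matrix.trace, Fin.sum_univ_two] <;>
    norm_num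

/-- The Pauli string with the letters `f`. -/
def pauliString (f : Fin n → Fin 4) : Op n := tensor fun i => pauli (f i)

theorem trace_tensor (s : Fin n → Matrix (Fin 2) (Fin 2) ℂ) :
    (tensor s).trace = ∏ i, (s i).trace := by
  simp only [tensor, Matrix.trace, Matrix.diag_apply, Matrix.of_apply, Finset.prod_univ_sum,
    Fintype.piFinset_univ]

theorem trace_pauliString_mul (f g : Fin n → Fin 4) :
    (pauliString f * pauliString g).trace = if f = g then 2 ^ n else 0 := by
  rw [pauliString, pauliString, tensor_mul, trace_tensor]
  simp only [trace_pauli_mul_pauli]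
  split_ifs with h
  · subst h; simp
  · obtain ⟨i, hi⟩ := Function.ne_iff.mp h
    exact Finset.prod_eq_zero (Finset.mem_univ i) (if_neg hi)

/-- The trace pairing `M ↦ tr (f M)` of operators with the Pauli string `f`. -/
def pairing (f : Fin n → Fin 4) : Op n →ₗ[ℝ] ℂ where
  toFun M := (pauliString f * M).trace
  map_add' A B := by rw [mul_add, Matrix.trace_add]
  map_smul' c A := by rw [mul_smul_comm, Matrix.trace_smul]; rfl

/-- The sum of the weights of the letters of a string; it is invariant under permutations. -/
def weight (w : Fin 4 → ℕ) (f : Fin n → Fin 4) : ℕ := ∑ i, w (f i)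

/-- The pairing of `f` with a translation orbit of `g` counts translates equal to `f`, with weight
`2 ^ n`. All contributions are nonnegative, so coincidences among the translates of `g` are
harmless. -/
theorem pairing_symmetrize (hn : 0 < n) (w : Fin 4 → ℕ) (f g : Fin n → Fin 4) :
    ∃ N : ℕ, pairing f (Complex.I • symmetrize (pauliString g)) = Complex.I * N ∧
      (weight w f ≠ weight w g → N = 0) ∧ (f = g → N ≠ 0) := by
  have key : ∀ k, (pauliString f * permConj (finRotate n ^ k) (pauliString g)).trace =
      if f = g ∘ (finRotate n ^ k).symm then 2 ^ n else 0 := by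
    intro k
    rw [← trace_pauliString_mul, pauliString, pauliString, permConj_tensor]
    rfl
  refine ⟨∑ k ∈ Finset.range n, if f = g ∘ (finRotate n ^ k).symm then 2 ^ n else 0, ?_, ?_, ?_⟩
  · simp only [pairing, LinearMap.coe_mk, AddHom.coe_mk, mul_smul_comm, Matrix.trace_smul,
      symmetrize, Finset.mul_sum, Matrix.trace_sum, key, smul_eq_mul]
    push_cast
    rw [Finset.mul_sum]
  · intro h
    refine Finset.sum_eq_zero fun k _ => if_neg ?_
    rintro rfl
    exact h (Equiv.sum_comp (finRotate n ^ k).symm fun i => w (g i))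
  · rintro rfl
    have h0 : f = f ∘ (finRotate n ^ 0).symm := rfl
    have : 0 < ∑ k ∈ Finset.range n, if f = f ∘ (finRotate n ^ k).symm then 2 ^ n else 0 :=
      Finset.sum_pos' (fun _ _ => Nat.zero_le _)
        ⟨0, Finset.mem_range.mpr hn, by rw [if_pos h0]; positivity⟩
    exact this.ne'

/-- The letters of the Pauli string `p ⊗ σ_x^{⊗ k} ⊗ q ⊗ 1^{⊗ (n - k - 2)}`. -/
def bondLetters (n : ℕ) (p q : Fin 4) (k : ℕ) (i : Fin n) : Fin 4 :=
  if (i : ℕ) = 0 then p else if (i : ℕ) ≤ k then 1 else if (i : ℕ) = k + 1 then q else 0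

theorem bond_eq_pauliString (p q : Fin 4) (k : ℕ) :
    bond n (pauli p) (pauli q) k = pauliString (bondLetters n p q k) := by
  rw [bond, pauliString]
  congr 1; ext1 i
  simp only [bondLetters]
  split_ifs <;> rfl

theorem weight_bondLetters (w : Fin 4 → ℕ) (hw : w 0 = 0) (p q : Fin 4) {k : ℕ} (hk : k + 1 < n) :
    weight w (bondLetters n p q k) = w p + k * w 1 + w q := by
  obtain ⟨m, rfl⟩ : ∃ m, n = (k + 1) + 1 + m := ⟨n - (k + 2), by omega⟩
  rw [weight]
  simp only [bondLetters]
  rw [Fin.sum_univ_eq_sum_range (fun i => w (if i = 0 then p else if i ≤ k then 1 else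
    if i = k + 1 then q else 0)), Finset.sum_range_add, Finset.sum_range_succ,
    Finset.sum_range_succ', Finset.sum_congr rfl (g := fun _ => w 1),
    Finset.sum_congr (s₁ := Finset.range m) rfl (g := fun _ => 0)]
  · simp [add_comm]
  · intro i _
    rw [if_neg (by omega), if_neg (by omega), if_neg (by omega), hw]
  · intro i hi
    rw [Finset.mem_range] at hi
    rw [if_neg (by omega), if_pos (by omega)]

/-- The letters of one Pauli string that occurs in a basis element. -/
def Label.letters : Label n → Fin n → Fin 4
  | .Y k => bondLetters n 2 2 k
  | .Z k => bondLetters n 3 3 k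
  | .YZ k => bondLetters n 3 2 k
  | .X => fun i => if (i : ℕ) = 0 then 1 else 0
  | .XX => fun i => if (i : ℕ) + 1 < n then 1 else 0

/-- Weights of the letters `1, σ_x, σ_y, σ_z`. The numbers of letters `σ_x, σ_y, σ_z` determine the
label of a string, and since it has fewer than `n` letters `σ_x`, these weights encode the three
numbers in one. -/
def letterWeight (n : ℕ) : Fin 4 → ℕ := ![0, 1, n, 3 * n]

theorem weight_letters (hn : 3 ≤ n) (l : Label n) :
    weight (letterWeight n) l.letters = match l with
      | .Y k => k + 2 * n
      | .Z k => k + 6 * n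
      | .YZ k => k + 4 * n
      | .X => 1
      | .XX => n - 1 := by
  obtain ⟨m, rfl⟩ : ∃ m, n = m + 1 := ⟨n - 1, by omega⟩
  rcases l with k | k | k | _ | _
  · rw [Label.letters, weight_bondLetters _ rfl _ _ (by omega)]
    simp [letterWeight]; ring
  · rw [Label.letters, weight_bondLetters _ rfl _ _ (by omega)]
    simp [letterWeight]; ring
  · rw [Label.letters, weight_bondLetters _ rfl _ _ (by omega)]
    simp [letterWeight]; ring
  · simp only [weight, Label.letters]
    rw [Fin.sum_univ_succ]
    simp [letterWeight]
  · simp only [weight, Label.letters]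
    rw [Fin.sum_univ_castSucc]
    simp [letterWeight]

theorem weight_letters_injective (hn : 3 ≤ n) :
    Function.Injective fun l : Label n => weight (letterWeight n) l.letters := by
  intro l l' h
  simp only [weight_letters hn] at h
  rcases l with k | k | k | _ | _ <;> rcases l' with k' | k' | k' | _ | _ <;>
    simp only [Label.Y.injEq, Label.Z.injEq, Label.YZ.injEq, reduceCtorEq, Fin.ext_iff] at h ⊢ <;>
    omega

theorem pairing_basisFamily (hn : 3 ≤ n) (f : Fin n → Fin 4) (l : Label n) :
    ∃ N : ℕ, pairing f (basisFamily n l) = Complex.I * N ∧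
      (weight (letterWeight n) f ≠ weight (letterWeight n) l.letters → N = 0) ∧
      (f = l.letters → N ≠ 0) := by
  have key := pairing_symmetrize (by omega : 0 < n) (letterWeight n) f
  have e : basisFamily n l = Complex.I • symmetrize (pauliString l.letters) ∨
      ∃ k, l = .YZ k := by
    rcases l with k | k | k | _ | _
    · exact Or.inl (by rw [Label.letters, ← bond_eq_pauliString]; rfl)
    · exact Or.inl (by rw [Label.letters, ← bond_eq_pauliString]; rfl)
    · exact Or.inr ⟨k, rfl⟩
    · refine Or.inl ?_
      rw [basisFamily, bX, pauliString]
      congr 3; ext1 i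
      simp only [Label.letters]; split_ifs <;> rfl
    · refine Or.inl ?_
      rw [basisFamily, bXX, pauliString]
      congr 3; ext1 i
      simp only [Label.letters]; split_ifs <;> rfl
  rcases e with e | ⟨k, rfl⟩
  · rw [e]; exact key _
  · obtain ⟨N, h1, h2, h3⟩ := key (bondLetters n 3 2 k)
    obtain ⟨N', h1', h2', -⟩ := key (bondLetters n 2 3 k)
    have hw : weight (letterWeight n) (bondLetters n 3 2 k) =
        weight (letterWeight n) (bondLetters n 2 3 k) := by
      rw [weight_bondLetters _ rfl _ _ (by omega), weight_bondLetters _ rfl _ _ (by omega)]; ring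
    refine ⟨N + N', ?_, fun h => ?_, fun h => ?_⟩
    · rw [← bond_eq_pauliString] at h1 h1'
      rw [basisFamily, bYZ, map_add, Nat.cast_add, mul_add]
      exact congrArg₂ _ h1 h1'
    · rw [h2 h, h2' (by rwa [← hw])]
    · have := h3 h; omega

theorem linearIndependent_basisFamily (hn : 3 ≤ n) : LinearIndependent ℝ (basisFamily n) := by
  rw [linearIndependent_iff']
  intro s c hc l hl
  have h := congrArg (pairing l.letters) hc
  rw [map_sum, map_zero, Finset.sum_eq_single l] at h
  · obtain ⟨N, h1, -, h3⟩ := pairing_basisFamily hn l.letters l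
    rw [map_smul, h1, smul_eq_zero] at h
    refine h.resolve_right ?_
    simp [h3 rfl]
  · intro l' _ hne
    obtain ⟨N, h1, h2, -⟩ := pairing_basisFamily hn l.letters l'
    rw [map_smul, h1, h2 fun e => hne (weight_letters_injective hn e).symm]
    simp
  · exact fun h => absurd hl h

end

/-! ### The polynomials `a_k` and the matrix `A_k` -/

theorem a_eq_chebyshev : ∀ k : ℕ, a k = Polynomial.Chebyshev.S ℝ k
  | 0 => by simp [a]
  | 1 => by simp [a]
  | k + 2 => by
    rw [a, a_eq_chebyshev (k + 1), a_eq_chebyshev k]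
    push_cast
    rw [Polynomial.Chebyshev.S_add_two]

theorem eval_a_two_mul_cos (k : ℕ) (θ : ℝ) :
    (a k).eval (2 * Real.cos θ) * Real.sin θ = Real.sin ((k + 1) * θ) := by
  rw [a_eq_chebyshev, Polynomial.Chebyshev.S_two_mul_real_cos]
  norm_cast

theorem a_monic_and_natDegree (k : ℕ) : (a k).Monic ∧ (a k).natDegree = k := by
  induction k using Nat.twoStepInduction with
  | zero => simp [a]
  | one => simp [a]
  | more k ih ih' =>
    have h : (Polynomial.X * a (k + 1)).Monic := Polynomial.monic_X.mul ih'.1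
    have hd : (Polynomial.X * a (k + 1)).natDegree = k + 2 := by
      rw [Polynomial.monic_X.natDegree_mul ih'.1, ih'.2, Polynomial.natDegree_X]; ring
    have hlt : (a k).degree < (Polynomial.X * a (k + 1)).degree :=
      Polynomial.degree_lt_degree (by rw [ih.2, hd]; omega)
    exact ⟨h.sub_of_left hlt, by rw [a, Polynomial.natDegree_sub_eq_left_of_natDegree_lt
      (by rw [ih.2, hd]; omega), hd]⟩

theorem natDegree_a (k : ℕ) : (a k).natDegree = k := (a_monic_and_natDegree k).2

theorem a_ne_zero (k : ℕ) : a k ≠ 0 := (a_monic_and_natDegree k).1.ne_zero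

/-- The roots of `a_{n-1}` are the `n - 1` numbers `2 cos (jπ/n)` with `0 < j < n`. -/
theorem roots_toFinset_a {n : ℕ} (hn : 0 < n) :
    (a (n - 1)).roots.toFinset.card = n - 1 ∧
      (a (n - 1)).roots.toFinset =
        (Finset.range (n - 1)).image fun j : ℕ => 2 * Real.cos ((j + 1) * (Real.pi / n)) := by
  have hn' : (0 : ℝ) < n := by exact_mod_cast hn
  have hpos : ∀ j < n - 1, 0 < ((j : ℝ) + 1) * (Real.pi / n) := fun j _ => by positivity
  have hlt : ∀ j < n - 1, ((j : ℝ) + 1) * (Real.pi / n) < Real.pi := fun j hj => by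
    have : (j : ℝ) + 1 < n := by exact_mod_cast (by omega : j + 1 < n)
    calc ((j : ℝ) + 1) * (Real.pi / n) < n * (Real.pi / n) := by gcongr
      _ = Real.pi := by field_simp
  have hcard : ((Finset.range (n - 1)).image
      fun j : ℕ => 2 * Real.cos ((j + 1) * (Real.pi / n))).card = n - 1 := by
    rw [Finset.card_image_of_injOn, Finset.card_range]
    intro i hi j hj h
    rw [Finset.coe_range, Set.mem_Iio] at hi hj
    have h1 := Real.injOn_cos ⟨(hpos i hi).le, (hlt i hi).le⟩ ⟨(hpos j hj).le, (hlt j hj).le⟩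
      (mul_left_cancel₀ two_ne_zero h)
    have h2 : (i : ℝ) + 1 = j + 1 := mul_right_cancel₀ (by positivity) h1
    exact_mod_cast add_right_cancel h2
  have hsub : ((Finset.range (n - 1)).image
      fun j : ℕ => 2 * Real.cos ((j + 1) * (Real.pi / n))) ⊆ (a (n - 1)).roots.toFinset := by
    intro x hx
    obtain ⟨j, hj, rfl⟩ := Finset.mem_image.mp hx
    rw [Finset.mem_range] at hj
    rw [Multiset.mem_toFinset, Polynomial.mem_roots (a_ne_zero _), Polynomial.IsRoot]
    have hs := (Real.sin_pos_of_pos_of_lt_pi (hpos j hj) (hlt j hj)).ne'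
    refine (mul_eq_zero.mp ?_).resolve_right hs
    rw [eval_a_two_mul_cos, Nat.cast_sub hn, Nat.cast_one, sub_add_cancel,
      show (n : ℝ) * (((j : ℝ) + 1) * (Real.pi / n)) = ((j + 1 : ℕ) : ℝ) * Real.pi by
        push_cast; field_simp]
    exact Real.sin_nat_mul_pi _
  have hle : (a (n - 1)).roots.toFinset.card ≤ n - 1 :=
    (Multiset.toFinset_card_le _).trans
      ((Polynomial.card_roots' _).trans (natDegree_a _).le)
  have heq := Finset.eq_of_subset_of_card_le hsub (hle.trans hcard.ge)
  exact ⟨heq ▸ hcard, heq.symm⟩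

theorem card_root {n : ℕ} (hn : 0 < n) : Nat.card (Root n) = n - 1 := by
  rw [← (roots_toFinset_a hn).1, ← Nat.card_eq_finsetCard]
  refine Nat.card_congr (Equiv.subtypeEquivRight fun x => ?_)
  rw [Multiset.mem_toFinset, Polynomial.mem_roots (a_ne_zero _)]

instance (n : ℕ) : Finite (Root n) :=
  (Polynomial.finite_setOfPred_isRoot (a_ne_zero (n - 1))).to_subtype

theorem sq_lt_four_of_isRoot {n : ℕ} (hn : 0 < n) {x : ℝ} (hx : (a (n - 1)).IsRoot x) :
    x ^ 2 < 4 := by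
  have h : x ∈ (a (n - 1)).roots.toFinset := by
    rwa [Multiset.mem_toFinset, Polynomial.mem_roots (a_ne_zero _)]
  rw [(roots_toFinset_a hn).2] at h
  obtain ⟨j, hj, rfl⟩ := Finset.mem_image.mp h
  rw [Finset.mem_range] at hj
  have hn' : (0 : ℝ) < n := by exact_mod_cast hn
  have : (j : ℝ) + 1 < n := by exact_mod_cast (by omega : j + 1 < n)
  have hs : 0 < Real.sin ((j + 1) * (Real.pi / n)) := by
    refine Real.sin_pos_of_pos_of_lt_pi (by positivity) ?_
    calc ((j : ℝ) + 1) * (Real.pi / n) < n * (Real.pi / n) := by gcongr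
      _ = Real.pi := by field_simp
  nlinarith [Real.sin_sq_add_cos_sq ((j + 1) * (Real.pi / n)), pow_pos hs 2]

theorem eval_a_add_two (k : ℕ) (x : ℝ) :
    (a (k + 2)).eval x = x * (a (k + 1)).eval x - (a k).eval x := by
  rw [a]; simp

/-- `A_m v` at `i` is `v (i + 1) + v (i - 1)`, where entries outside the range count as `0`. -/
theorem A_mulVec {m : ℕ} (v : ℕ → ℝ) (i : Fin m) :
    (A m *ᵥ fun j => v j) i =
      (if (i : ℕ) + 1 < m then v (i + 1) else 0) + if 0 < (i : ℕ) then v (i - 1) else 0 := by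
  have h : ∀ j : Fin m, A m i j * v j =
      (if (i : ℕ) + 1 = j then v j else 0) + if (j : ℕ) + 1 = i then v j else 0 := by
    intro j
    rw [A, Matrix.of_apply]
    split_ifs <;> first | omega | simp
  simp only [Matrix.mulVec, dotProduct, h, Finset.sum_add_distrib]
  congr 1
  · split_ifs with hi
    · rw [Finset.sum_eq_single ⟨i + 1, hi⟩]
      · simp
      · intro j _ hj
        exact if_neg fun e => hj (Fin.ext e.symm)
      · simp
    · exact Finset.sum_eq_zero fun j _ => if_neg (by omega)
  · split_ifs with hi
    · rw [Finset.sum_eq_single ⟨i - 1, by omega⟩]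
      · rw [if_pos]; simp; omega
      · intro j _ hj
        exact if_neg fun e => hj (Fin.ext (by simp; omega))
      · simp
    · exact Finset.sum_eq_zero fun j _ => if_neg (by omega)

/-- The vector `(a_0(x), …, a_{m-1}(x))`. -/
def aVec (m : ℕ) (x : ℝ) : Fin m → ℝ := fun i => (a i).eval x

theorem hasEigenvector_aVec {m : ℕ} (hm : 0 < m) {x : ℝ} (hx : (a m).IsRoot x) :
    Module.End.HasEigenvector (Matrix.toLin' (A m)) x (aVec m x) := by
  rw [Module.End.hasEigenvector_iff, Module.End.mem_eigenspace_iff]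
  constructor
  · ext1 i
    rw [Matrix.toLin'_apply]
    unfold aVec
    rw [A_mulVec (fun k => (a k).eval x), Pi.smul_apply, smul_eq_mul]
    have h1 : (if (i : ℕ) + 1 < m then (a (i + 1)).eval x else 0) = (a (i + 1)).eval x := by
      split_ifs with h
      · rfl
      · rw [show (i : ℕ) + 1 = m by omega]; exact hx.symm
    rw [h1]
    rcases i with ⟨_ | k, hk⟩
    · simp [a]
    · simp [eval_a_add_two]
  · intro h
    have := congrFun h ⟨0, hm⟩
    simp [aVec, a] at this

theorem isRoot_a_iff_hasEigenvalue {m : ℕ} (hm : 0 < m) (x : ℝ) :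
    (a m).IsRoot x ↔ Module.End.HasEigenvalue (Matrix.toLin' (A m)) x := by
  refine ⟨fun h => Module.End.hasEigenvalue_of_hasEigenvector (hasEigenvector_aVec hm h),
    fun h => ?_⟩
  obtain ⟨w, hw⟩ := h.exists_hasEigenvector
  obtain ⟨hw, hw0⟩ := Module.End.hasEigenvector_iff.mp hw
  rw [Module.End.mem_eigenspace_iff, Matrix.toLin'_apply] at hw
  -- Extended by `0`, an eigenvector satisfies the recursion of the polynomials `a_k`.
  set v : ℕ → ℝ := fun k => if h : k < m then w ⟨k, h⟩ else 0 with hv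
  have hwv : w = fun j : Fin m => v j := by ext j; simp [hv]
  have hrec : ∀ k < m, v (k + 1) = x * v k - if 0 < k then v (k - 1) else 0 := by
    intro k hk
    have := congrFun hw ⟨k, hk⟩
    rw [hwv, A_mulVec, Pi.smul_apply, smul_eq_mul] at this
    have e : (if k + 1 < m then v (k + 1) else 0) = v (k + 1) := by
      split_ifs with h
      · rfl
      · simp [hv, h]
    simp only [e] at this
    linarith
  have hva : ∀ k, k ≤ m → v k = v 0 * (a k).eval x := by
    intro k
    induction k using Nat.twoStepInduction with
    | zero => simp [a]
    | one => intro h; rw [hrec 0 hm]; simp [a]; ring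
    | more k ih ih' =>
      intro h
      rw [hrec (k + 1) (by omega), ih' (by omega), if_pos (by omega), Nat.add_sub_cancel,
        ih (by omega), eval_a_add_two]
      ring
  have hm0 : v m = 0 := by simp [hv]
  rw [hva m le_rfl] at hm0
  refine (mul_eq_zero.mp hm0).resolve_left fun h0 => hw0 ?_
  rw [hwv]; ext j
  simp [hva j j.isLt.le, h0]

/-- The vectors `aVec (n - 1) x` at the `n - 1` roots are eigenvectors for distinct eigenvalues of
`A_{n-1}`, so they span. -/
theorem span_aVec {n : ℕ} (hn : 2 ≤ n) :
    Submodule.span ℝ (Set.range fun x : Root n => aVec (n - 1) x) = ⊤ := by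
  have := Fintype.ofFinite (Root n)
  refine LinearIndependent.span_eq_top_of_card_eq_finrank' ?_ ?_
  · exact Module.End.eigenvectors_linearIndependent' (Matrix.toLin' (A (n - 1)))
      (fun x : Root n => (x : ℝ)) Subtype.val_injective _
      fun x => hasEigenvector_aVec (by omega) x.2
  · rw [← Nat.card_eq_fintype_card, card_root (by omega), Module.finrank_fin_fun]

/-! ### Lie algebras with two generators -/

/-- The brackets of `Q 0` and `P 0` with three sequences of elements of a real Lie algebra. In terms
of `A_{k+1} = P k`, `A_{-k} = Q k`, `G_{-k} = -G_k` these are the brackets of `A_0` and `A_1` in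
Onsager's relations `⁅A_l, A_m⁆ = 2 G_{m-l}` and `⁅G_l, A_m⁆ = 4 (A_{m+l} - A_{m-l})`, with the
periodicity of a chain of length `n` in the form `G_n = 0`. -/
structure ChainRelations {L : Type*} [LieRing L] [LieAlgebra ℝ L] (n : ℕ) (P Q G : ℕ → L) :
    Prop where
  G_zero : G 0 = 0
  G_last : G n = 0
  lie_Q_P : ∀ k, ⁅Q 0, P k⁆ = (2 : ℝ) • G (k + 1)
  lie_Q_Q : ∀ k, ⁅Q 0, Q k⁆ = (-2 : ℝ) • G k
  lie_Q_G : ∀ k, ⁅Q 0, G (k + 1)⁆ = (4 : ℝ) • (Q (k + 1) - P k)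
  lie_P_P : ∀ k, ⁅P 0, P k⁆ = (2 : ℝ) • G k
  lie_P_Q : ∀ k, ⁅P 0, Q k⁆ = (-2 : ℝ) • G (k + 1)
  lie_P_G : ∀ k, ⁅P 0, G (k + 1)⁆ = (4 : ℝ) • (Q k - P (k + 1))

/-- The elements `u` and `v` generate the real Lie algebra `L`. -/
def LieGenerate {L : Type*} [LieRing L] [LieAlgebra ℝ L] (u v : L) : Prop :=
  ∀ K : LieSubalgebra ℝ L, u ∈ K → v ∈ K → K = ⊤

section
variable {L : Type*} [LieRing L] [LieAlgebra ℝ L] {u v : L}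

/-- A subspace stable under brackets with the two generators is stable under all brackets. -/
theorem LieGenerate.lie_mem (gen : LieGenerate u v) {N : Submodule ℝ L}
    (hu : ∀ m ∈ N, ⁅u, m⁆ ∈ N) (hv : ∀ m ∈ N, ⁅v, m⁆ ∈ N) (x : L) {m : L} (hm : m ∈ N) :
    ⁅x, m⁆ ∈ N := by
  let K : LieSubalgebra ℝ L :=
    { carrier := {x | ∀ m ∈ N, ⁅x, m⁆ ∈ N}
      zero_mem' := fun m _ => by rw [zero_lie]; exact N.zero_mem
      add_mem' := fun hx hy m hm => by rw [add_lie]; exact N.add_mem (hx m hm) (hy m hm)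
      smul_mem' := fun c x hx m hm => by rw [smul_lie]; exact N.smul_mem c (hx m hm)
      lie_mem' := fun hx hy m hm => by
        rw [lie_lie]; exact N.sub_mem (hx _ (hy m hm)) (hy _ (hx m hm)) }
  have hK : x ∈ K := by rw [gen K hu hv]; exact LieSubalgebra.mem_top x
  exact hK m hm

/-- A subspace stable under brackets with the two generators, as an ideal. -/
def LieGenerate.ideal (gen : LieGenerate u v) (N : Submodule ℝ L)
    (hu : ∀ m ∈ N, ⁅u, m⁆ ∈ N) (hv : ∀ m ∈ N, ⁅v, m⁆ ∈ N) : LieIdeal ℝ L :=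
  { N with lie_mem := fun {x _} hm => gen.lie_mem hu hv x hm }

theorem LieGenerate.eq_top (gen : LieGenerate u v) {N : Submodule ℝ L}
    (hu : ∀ m ∈ N, ⁅u, m⁆ ∈ N) (hv : ∀ m ∈ N, ⁅v, m⁆ ∈ N) (huN : u ∈ N) (hvN : v ∈ N) :
    N = ⊤ := by
  let K : LieSubalgebra ℝ L := { N with lie_mem' := fun {x _} _ hm => gen.lie_mem hu hv x hm }
  have hK := gen K huN hvN
  exact eq_top_iff.mpr fun x _ => (hK ▸ LieSubalgebra.mem_top x : x ∈ K)

theorem LieGenerate.mem_center (gen : LieGenerate u v) {w : L} (hu : ⁅u, w⁆ = 0)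
    (hv : ⁅v, w⁆ = 0) : w ∈ LieAlgebra.center ℝ L := by
  rw [LieModule.mem_maxTrivSubmodule]
  intro x
  let K : LieSubalgebra ℝ L :=
    { carrier := {x | ⁅x, w⁆ = 0}
      zero_mem' := zero_lie w
      add_mem' := fun {x y} hx hy => by
        change ⁅x + y, w⁆ = 0
        rw [add_lie, show ⁅x, w⁆ = 0 from hx, show ⁅y, w⁆ = 0 from hy, add_zero]
      smul_mem' := fun c x hx => by
        change ⁅c • x, w⁆ = 0
        rw [smul_lie, show ⁅x, w⁆ = 0 from hx, smul_zero]
      lie_mem' := fun {x y} hx hy => by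
        change ⁅⁅x, y⁆, w⁆ = 0
        rw [lie_lie, show ⁅x, w⁆ = 0 from hx, show ⁅y, w⁆ = 0 from hy, lie_zero, lie_zero,
          sub_zero] }
  exact (gen K hu hv ▸ LieSubalgebra.mem_top x : x ∈ K)

theorem lie_mem_span {u : L} {s : Set L} (h : ∀ m ∈ s, ⁅u, m⁆ ∈ Submodule.span ℝ s) :
    ∀ m ∈ Submodule.span ℝ s, ⁅u, m⁆ ∈ Submodule.span ℝ s := by
  intro m hm
  induction hm using Submodule.span_induction with
  | mem x hx => exact h x hx
  | zero => rw [lie_zero]; exact Submodule.zero_mem _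
  | add x y _ _ hx hy => rw [lie_add]; exact Submodule.add_mem _ hx hy
  | smul c x _ hx => rw [lie_smul]; exact Submodule.smul_mem _ c hx

end

section
variable {L : Type*} [LieRing L] [LieAlgebra ℝ L] {n : ℕ} {P Q G : ℕ → L}

namespace ChainRelations

/-- The relations express all elements as iterated brackets of `Q 0` and `P 0`. -/
theorem mem_of_generators (R : ChainRelations n P Q G) (K : LieSubalgebra ℝ L) (hQ : Q 0 ∈ K)
    (hP : P 0 ∈ K) (k : ℕ) : P k ∈ K ∧ Q k ∈ K ∧ G k ∈ K := by
  induction k with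
  | zero => exact ⟨hP, hQ, by rw [R.G_zero]; exact K.zero_mem⟩
  | succ k ih =>
    have hG : G (k + 1) ∈ K := by
      rw [show G (k + 1) = (2⁻¹ : ℝ) • ⁅Q 0, P k⁆ by rw [R.lie_Q_P]; module]
      exact K.smul_mem _ (K.lie_mem hQ ih.1)
    refine ⟨?_, ?_, hG⟩
    · rw [show P (k + 1) = Q k - (4⁻¹ : ℝ) • ⁅P 0, G (k + 1)⁆ by rw [R.lie_P_G]; module]
      exact K.sub_mem ih.2.1 (K.smul_mem _ (K.lie_mem hP hG))
    · rw [show Q (k + 1) = P k + (4⁻¹ : ℝ) • ⁅Q 0, G (k + 1)⁆ by rw [R.lie_Q_G]; module]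
      exact K.add_mem ih.1 (K.smul_mem _ (K.lie_mem hQ hG))

/-- The elements `Q k` and `P k` with `k < n` and `G k` with `0 < k < n`, indexed by the labels; the
sign of `Q 0` is that of `𝐗`. -/
def family (n : ℕ) (P Q G : ℕ → L) : Label n → L
  | .Y k => Q (k + 1)
  | .Z k => P k
  | .YZ k => G (k + 1)
  | .X => -Q 0
  | .XX => P (n - 1)

theorem span_family (R : ChainRelations n P Q G) (gen : LieGenerate (Q 0) (P 0)) (hn : 2 ≤ n) :
    Submodule.span ℝ (Set.range (family n P Q G)) = ⊤ := by
  set S := Submodule.span ℝ (Set.range (family n P Q G)) with hS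
  have mem : ∀ l, family n P Q G l ∈ S := fun l => Submodule.subset_span ⟨l, rfl⟩
  have hP : ∀ k < n, P k ∈ S := by
    intro k hk
    by_cases h : k < n - 1
    · exact mem (.Z ⟨k, h⟩)
    · rw [show k = n - 1 by omega]; exact mem .XX
  have hQ : ∀ k < n, Q k ∈ S := by
    rintro (_ | k) hk
    · have := S.neg_mem (mem .X)
      rwa [family, neg_neg] at this
    · exact mem (.Y ⟨k, by omega⟩)
  have hG : ∀ k ≤ n, G k ∈ S := by
    rintro (_ | k) hk
    · rw [R.G_zero]; exact S.zero_mem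
    · by_cases h : k < n - 1
      · exact mem (.YZ ⟨k, h⟩)
      · rw [show k + 1 = n by omega, R.G_last]; exact S.zero_mem
  have stable : ∀ w : L, (∀ k < n, ⁅w, P k⁆ ∈ S) → (∀ k < n, ⁅w, Q k⁆ ∈ S) →
      (∀ k < n - 1, ⁅w, G (k + 1)⁆ ∈ S) → ∀ m ∈ S, ⁅w, m⁆ ∈ S := by
    intro w h1 h2 h3
    refine lie_mem_span ?_
    rintro _ ⟨k | k | k | _ | _, rfl⟩
    · exact h2 (k + 1) (by omega)
    · exact h1 k (by omega)
    · exact h3 k (by omega)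
    · rw [family, lie_neg]; exact S.neg_mem (h2 0 (by omega))
    · exact h1 (n - 1) (by omega)
  refine gen.eq_top (stable _ ?_ ?_ ?_) (stable _ ?_ ?_ ?_) (hQ 0 (by omega)) (hP 0 (by omega))
  · intro k hk; rw [R.lie_Q_P]; exact S.smul_mem _ (hG _ (by omega))
  · intro k hk; rw [R.lie_Q_Q]; exact S.smul_mem _ (hG _ (by omega))
  · intro k hk; rw [R.lie_Q_G]
    exact S.smul_mem _ (S.sub_mem (hQ _ (by omega)) (hP _ (by omega)))
  · intro k hk; rw [R.lie_P_P]; exact S.smul_mem _ (hG _ (by omega))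
  · intro k hk; rw [R.lie_P_Q]; exact S.smul_mem _ (hG _ (by omega))
  · intro k hk; rw [R.lie_P_G]
    exact S.smul_mem _ (S.sub_mem (hQ _ (by omega)) (hP _ (by omega)))

/-! ### Central elements and the ideals of the roots -/

/-- The sum of the `Q k` with `k + e` even and the `P k` with `k + e` odd, for `k < n`. It depends
on `e` through its parity only. -/
def central (n : ℕ) (P Q : ℕ → L) (e : ℕ) : L :=
  ∑ k ∈ Finset.range n, if Even (k + e) then Q k else P k

/-- The brackets with the summands telescope, and the ends vanish since `G 0 = G n = 0`. -/
theorem lie_Q_central (R : ChainRelations n P Q G) (e : ℕ) : ⁅Q 0, central n P Q e⁆ = 0 := by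
  have h : ∀ k, ⁅Q 0, if Even (k + e) then Q k else P k⁆ =
      (if Even (k + 1 + e) then (2 : ℝ) • G (k + 1) else 0) -
        if Even (k + e) then (2 : ℝ) • G k else 0 := by
    intro k
    by_cases hk : Even (k + e)
    · rw [if_pos hk, if_pos hk, if_neg (by grind), R.lie_Q_Q]; module
    · rw [if_neg hk, if_neg hk, if_pos (by grind), R.lie_Q_P]; module
  rw [central, lie_sum, Finset.sum_congr rfl fun k _ => h k,
    Finset.sum_range_sub (fun k => if Even (k + e) then (2 : ℝ) • G k else 0), R.G_zero, R.G_last]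
  simp

theorem lie_P_central (R : ChainRelations n P Q G) (e : ℕ) : ⁅P 0, central n P Q e⁆ = 0 := by
  have h : ∀ k, ⁅P 0, if Even (k + e) then Q k else P k⁆ =
      (if Even (k + 1 + e) then 0 else (-2 : ℝ) • G (k + 1)) -
        if Even (k + e) then 0 else (-2 : ℝ) • G k := by
    intro k
    by_cases hk : Even (k + e)
    · rw [if_pos hk, if_pos hk, if_neg (by grind), R.lie_P_Q]; module
    · rw [if_neg hk, if_neg hk, if_pos (by grind), R.lie_P_P]; module
  rw [central, lie_sum, Finset.sum_congr rfl fun k _ => h k,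
    Finset.sum_range_sub (fun k => if Even (k + e) then 0 else (-2 : ℝ) • G k), R.G_zero, R.G_last]
  simp

/-- The element `X̂_x` in terms of the sequences. -/
def vecX (n : ℕ) (P Q : ℕ → L) (x : ℝ) : L :=
  ∑ k ∈ Finset.range (n - 1), (a k).eval x • (P (k + 1) - Q k)

/-- The element `Ŷ_x` in terms of the sequences. -/
def vecY (n : ℕ) (P Q : ℕ → L) (x : ℝ) : L :=
  ∑ k ∈ Finset.range (n - 1), (a k).eval x • (Q (k + 1) - P k)

/-- The element `Ẑ_x` in terms of the sequences. -/
def vecZ (n : ℕ) (G : ℕ → L) (x : ℝ) : L :=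
  ∑ k ∈ Finset.range (n - 1), (a k).eval x • G (k + 1)

theorem lie_Q_vecZ (R : ChainRelations n P Q G) (x : ℝ) :
    ⁅Q 0, vecZ n G x⁆ = (4 : ℝ) • vecY n P Q x := by
  rw [vecZ, vecY, lie_sum, Finset.smul_sum]
  refine Finset.sum_congr rfl fun k _ => ?_
  rw [lie_smul, R.lie_Q_G]; module

theorem lie_P_vecZ (R : ChainRelations n P Q G) (x : ℝ) :
    ⁅P 0, vecZ n G x⁆ = (-4 : ℝ) • vecX n P Q x := by
  rw [vecZ, vecX, lie_sum, Finset.smul_sum]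
  refine Finset.sum_congr rfl fun k _ => ?_
  rw [lie_smul, R.lie_P_G]; module

theorem lie_Q_vecY (R : ChainRelations n P Q G) (x : ℝ) :
    ⁅Q 0, vecY n P Q x⁆ = (-4 : ℝ) • vecZ n G x := by
  rw [vecZ, vecY, lie_sum, Finset.smul_sum]
  refine Finset.sum_congr rfl fun k _ => ?_
  rw [lie_smul, lie_sub, R.lie_Q_Q, R.lie_Q_P]; module

theorem lie_P_vecX (R : ChainRelations n P Q G) (x : ℝ) :
    ⁅P 0, vecX n P Q x⁆ = (4 : ℝ) • vecZ n G x := by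
  rw [vecZ, vecX, lie_sum, Finset.smul_sum]
  refine Finset.sum_congr rfl fun k _ => ?_
  rw [lie_smul, lie_sub, R.lie_P_Q, R.lie_P_P]; module

/-- Summation by parts with `x a_k = a_{k+1} + a_{k-1}`; the boundary term at the upper end vanishes
because `x` is a root of `a_{n-1}` and `G n = 0`. -/
theorem sum_a_smul_shift (R : ChainRelations n P Q G) (hn : 2 ≤ n) {x : ℝ}
    (hx : (a (n - 1)).IsRoot x) :
    ∑ k ∈ Finset.range (n - 1), (a k).eval x • (G (k + 2) + G k) = x • vecZ n G x := by
  obtain ⟨m, rfl⟩ : ∃ m, n = m + 2 := ⟨n - 2, by omega⟩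
  have h : ∀ m, ∑ k ∈ Finset.range (m + 1), (a k).eval x • (G (k + 2) + G k) =
      x • ∑ k ∈ Finset.range (m + 1), (a k).eval x • G (k + 1) +
        (a m).eval x • G (m + 2) - (a (m + 1)).eval x • G (m + 1) := by
    intro m
    induction m with
    | zero => simp [a, R.G_zero]
    | succ m ih =>
      rw [Finset.sum_range_succ, ih, Finset.sum_range_succ _ (m + 1), eval_a_add_two]
      module
  rw [vecZ, show m + 2 - 1 = m + 1 by omega, h, R.G_last,
    show (a (m + 1)).eval x = 0 from hx, smul_zero, zero_smul, add_zero, sub_zero]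

theorem lie_P_vecY (R : ChainRelations n P Q G) (hn : 2 ≤ n) {x : ℝ}
    (hx : (a (n - 1)).IsRoot x) : ⁅P 0, vecY n P Q x⁆ = (-2 * x) • vecZ n G x := by
  rw [← smul_smul, ← R.sum_a_smul_shift hn hx, vecY, lie_sum, Finset.smul_sum]
  refine Finset.sum_congr rfl fun k _ => ?_
  rw [lie_smul, lie_sub, R.lie_P_Q, R.lie_P_P]; module

theorem lie_Q_vecX (R : ChainRelations n P Q G) (hn : 2 ≤ n) {x : ℝ}
    (hx : (a (n - 1)).IsRoot x) : ⁅Q 0, vecX n P Q x⁆ = (2 * x) • vecZ n G x := by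
  rw [← smul_smul, ← R.sum_a_smul_shift hn hx, vecX, lie_sum, Finset.smul_sum]
  refine Finset.sum_congr rfl fun k _ => ?_
  rw [lie_smul, lie_sub, R.lie_Q_Q, R.lie_Q_P]; module

/-- The ideal spanned by `X̂_x, Ŷ_x, Ẑ_x` for a root `x` of `a_{n-1}`. -/
def rootIdeal (R : ChainRelations n P Q G) (gen : LieGenerate (Q 0) (P 0)) (hn : 2 ≤ n)
    (x : Root n) : LieIdeal ℝ L :=
  gen.ideal (Submodule.span ℝ {vecX n P Q x, vecY n P Q x, vecZ n G x})
    (lie_mem_span (by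
      rintro m (rfl | rfl | rfl)
      · rw [R.lie_Q_vecX hn x.2]
        exact Submodule.smul_mem _ _ (Submodule.subset_span (by simp))
      · rw [R.lie_Q_vecY]
        exact Submodule.smul_mem _ _ (Submodule.subset_span (by simp))
      · rw [R.lie_Q_vecZ]
        exact Submodule.smul_mem _ _ (Submodule.subset_span (by simp))))
    (lie_mem_span (by
      rintro m (rfl | rfl | rfl)
      · rw [R.lie_P_vecX]
        exact Submodule.smul_mem _ _ (Submodule.subset_span (by simp))
      · rw [R.lie_P_vecY hn x.2]
        exact Submodule.smul_mem _ _ (Submodule.subset_span (by simp))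
      · rw [R.lie_P_vecZ]
        exact Submodule.smul_mem _ _ (Submodule.subset_span (by simp))))

end ChainRelations
end

/-! ### The direct sum decomposition and the center -/

/-- Submodules that together span the space, with upper bounds for their dimensions that add up to
its dimension, form a direct sum decomposition, and the bounds are attained. -/
theorem isInternal_of_finrank_le {V ι : Type*} [AddCommGroup V] [Module ℝ V]
    [FiniteDimensional ℝ V] [Fintype ι] [DecidableEq ι] (N : ι → Submodule ℝ V) (d : ι → ℕ)
    (htop : ⨆ i, N i = ⊤) (hd : ∀ i, Module.finrank ℝ (N i) ≤ d i)
    (hsum : ∑ i, d i = Module.finrank ℝ V) :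
    DirectSum.IsInternal N ∧ ∀ i, Module.finrank ℝ (N i) = d i := by
  have hsurj : Function.Surjective (DirectSum.coeLinearMap N) := by
    rw [← LinearMap.range_eq_top, DirectSum.range_coeLinearMap, htop]
  have h1 : Module.finrank ℝ (DirectSum ι fun i => N i) = ∑ i, Module.finrank ℝ (N i) :=
    Module.finrank_directSum (R := ℝ) fun i => N i
  have h2 : Module.finrank ℝ V ≤ Module.finrank ℝ (DirectSum ι fun i => N i) :=
    LinearMap.finrank_le_finrank_of_surjective hsurj
  have h3 : ∑ i, Module.finrank ℝ (N i) ≤ ∑ i, d i := Finset.sum_le_sum fun i _ => hd i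
  have h4 : ∑ i, Module.finrank ℝ (N i) = ∑ i, d i := by omega
  refine ⟨⟨(LinearMap.injective_iff_surjective_of_finrank_eq_finrank (by omega)).mpr hsurj, hsurj⟩,
    fun i => (Finset.sum_eq_sum_iff_of_le fun i _ => hd i).mp h4 i (Finset.mem_univ i)⟩

theorem eq_zero_of_linearIndependent_triple {V : Type*} [AddCommGroup V] [Module ℝ V] {x y z : V}
    (h : LinearIndependent ℝ ![x, y, z]) {α β γ : ℝ} (h0 : α • x + β • y + γ • z = 0) :
    α = 0 ∧ β = 0 ∧ γ = 0 := by
  have := Fintype.linearIndependent_iff.mp h ![α, β, γ] (by simpa [Fin.sum_univ_three] using h0)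
  exact ⟨this 0, this 1, this 2⟩

/-- The labels are three families of `n - 1` elements and two more. -/
def labelEquiv (n : ℕ) : Label n ≃ (Fin 3 × Fin (n - 1)) ⊕ Fin 2 where
  toFun
    | .Y k => Sum.inl (0, k)
    | .Z k => Sum.inl (1, k)
    | .YZ k => Sum.inl (2, k)
    | .X => Sum.inr 0
    | .XX => Sum.inr 1
  invFun
    | Sum.inl (0, k) => .Y k
    | Sum.inl (1, k) => .Z k
    | Sum.inl (2, k) => .YZ k
    | Sum.inr 0 => .X
    | Sum.inr 1 => .XX
  left_inv l := by rcases l <;> rfl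
  right_inv l := by
    rcases l with ⟨i, k⟩ | i
    · fin_cases i <;> rfl
    · fin_cases i <;> rfl

instance (n : ℕ) : Fintype (Label n) := Fintype.ofEquiv _ (labelEquiv n).symm

theorem card_label {n : ℕ} (hn : 1 ≤ n) : Fintype.card (Label n) = 3 * n - 1 := by
  rw [Fintype.card_congr (labelEquiv n)]
  simp only [Fintype.card_sum, Fintype.card_prod, Fintype.card_fin]
  omega

namespace ChainRelations
variable {L : Type*} [LieRing L] [LieAlgebra ℝ L] {n : ℕ} {P Q G : ℕ → L}

theorem mem_rootIdeal (R : ChainRelations n P Q G) (gen : LieGenerate (Q 0) (P 0)) (hn : 2 ≤ n)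
    (x : Root n) : vecX n P Q x ∈ R.rootIdeal gen hn x ∧ vecY n P Q x ∈ R.rootIdeal gen hn x ∧
      vecZ n G x ∈ R.rootIdeal gen hn x :=
  ⟨Submodule.subset_span (by simp), Submodule.subset_span (by simp),
    Submodule.subset_span (by simp)⟩

/-- The ideal spanned by the two central elements. -/
def centralIdeal (R : ChainRelations n P Q G) (gen : LieGenerate (Q 0) (P 0)) : LieIdeal ℝ L :=
  gen.ideal (Submodule.span ℝ {central n P Q 0, central n P Q 1})
    (lie_mem_span (by
      rintro m (rfl | rfl) <;> rw [R.lie_Q_central] <;> exact Submodule.zero_mem _))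
    (lie_mem_span (by
      rintro m (rfl | rfl) <;> rw [R.lie_P_central] <;> exact Submodule.zero_mem _))

/-- The summands of the decomposition: the central ideal at `none`, and the ideals of the roots. -/
def summand (R : ChainRelations n P Q G) (gen : LieGenerate (Q 0) (P 0)) (hn : 2 ≤ n)
    (o : Option (Root n)) : LieIdeal ℝ L :=
  o.elim (R.centralIdeal gen) (R.rootIdeal gen hn)

/-- Let `T` be the sum of all summands. The `n - 1` elements `Ẑ_x` span the same space as
`G 1, …, G (n - 1)`, so `T` contains their brackets with `Q 0` and `P 0`, which are the differences
of consecutive terms in the two central elements. Hence `T` contains `Q 0` and `P 0`. -/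
theorem iSup_summand (R : ChainRelations n P Q G) (gen : LieGenerate (Q 0) (P 0)) (hn : 2 ≤ n) :
    ⨆ o, (R.summand gen hn o).toSubmodule = ⊤ := by
  rw [← LieSubmodule.iSup_toSubmodule]
  set T : LieIdeal ℝ L := ⨆ o, R.summand gen hn o with hT
  have hle : ∀ o, R.summand gen hn o ≤ T := fun o => le_iSup (R.summand gen hn) o
  have hZ : ∀ x : Root n, vecZ n G x ∈ T :=
    fun x => hle (some x) (R.mem_rootIdeal gen hn x).2.2
  have hC : ∀ e : ℕ, e < 2 → central n P Q e ∈ T := by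
    intro e he
    refine hle none (Submodule.subset_span ?_)
    interval_cases e <;> simp
  have hG : ∀ k < n - 1, G (k + 1) ∈ T := by
    intro k hk
    let φ := Fintype.linearCombination ℝ (fun k : Fin (n - 1) => G (k + 1))
    have h : (⊤ : Submodule ℝ _).map φ ≤ T.toSubmodule := by
      rw [← span_aVec hn, Submodule.map_span, Submodule.span_le]
      rintro _ ⟨_, ⟨x, rfl⟩, rfl⟩
      have : φ (aVec (n - 1) x) = vecZ n G x := by
        rw [Fintype.linearCombination_apply, vecZ, Finset.sum_range]
        rfl
      rw [this]
      exact hZ x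
    have h1 : φ (Pi.single ⟨k, hk⟩ 1) = G (k + 1) := by
      rw [Fintype.linearCombination_apply_single, one_smul]
    rw [← h1]
    exact h (Submodule.mem_map_of_mem trivial)
  have hQ : ∀ k < n - 1, Q (k + 1) - P k ∈ T := by
    intro k hk
    have := T.smul_mem (4⁻¹ : ℝ) (lie_mem_right ℝ L T (Q 0) _ (hG k hk))
    rw [R.lie_Q_G, smul_smul] at this
    norm_num at this
    exact this
  have hP : ∀ k < n - 1, P (k + 1) - Q k ∈ T := by
    intro k hk
    have := T.smul_mem (-4⁻¹ : ℝ) (lie_mem_right ℝ L T (P 0) _ (hG k hk))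
    rw [R.lie_P_G, smul_smul] at this
    norm_num at this
    exact this
  -- Modulo `T`, all terms of the sum defining a central element agree.
  have hf : ∀ e < 2, (if Even e then Q 0 else P 0) ∈ T := by
    intro e he
    set f : ℕ → L := fun k => if Even (k + e) then Q k else P k with hf
    have hstep : ∀ k < n, f k - f 0 ∈ T := by
      intro k
      induction k with
      | zero => intro _; rw [sub_self]; exact T.zero_mem
      | succ k ih =>
        intro hk
        have h1 : f (k + 1) - f k ∈ T := by
          by_cases h : Even (k + e)
          · simp only [hf, if_pos h, if_neg (show ¬ Even (k + 1 + e) by grind)]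
            exact hP k (by omega)
          · simp only [hf, if_neg h, if_pos (show Even (k + 1 + e) by grind)]
            exact hQ k (by omega)
        have := T.add_mem h1 (ih (by omega))
        rwa [sub_add_sub_cancel] at this
    have h2 : (n : ℝ) • f 0 ∈ T := by
      have h3 : ∑ k ∈ Finset.range n, (f k - f 0) ∈ T :=
        T.toSubmodule.sum_mem fun k hk => hstep k (Finset.mem_range.mp hk)
      rw [Finset.sum_sub_distrib, Finset.sum_const, Finset.card_range] at h3
      have := T.sub_mem (hC e he) h3
      rw [central, sub_sub_cancel, ← Nat.cast_smul_eq_nsmul ℝ] at this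
      exact this
    have h4 := T.smul_mem (n : ℝ)⁻¹ h2
    rw [smul_smul, inv_mul_cancel₀ (by positivity), one_smul] at h4
    simpa [hf] using h4
  exact gen.eq_top (fun m hm => lie_mem_right ℝ L T _ m hm) (fun m hm => lie_mem_right ℝ L T _ m hm)
    (by simpa using hf 0 (by omega)) (by simpa using hf 1 (by omega))

theorem finrank_eq (R : ChainRelations n P Q G) (gen : LieGenerate (Q 0) (P 0))
    (hn : 2 ≤ n) (li : LinearIndependent ℝ (family n P Q G)) : Module.finrank ℝ L = 3 * n - 1 := by
  rw [Module.finrank_eq_card_basis (Module.Basis.mk li (R.span_family gen hn).ge),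
    card_label (by omega)]

theorem isInternal_summand (R : ChainRelations n P Q G) (gen : LieGenerate (Q 0) (P 0))
    (hn : 2 ≤ n) (li : LinearIndependent ℝ (family n P Q G)) [DecidableEq (Root n)] :
    DirectSum.IsInternal (fun o => (R.summand gen hn o).toSubmodule) ∧
    ∀ o, Module.finrank ℝ (R.summand gen hn o).toSubmodule = o.elim 2 fun _ => 3 := by
  have := Fintype.ofFinite (Root n)
  have : FiniteDimensional ℝ L :=
    (Module.Basis.mk li (R.span_family gen hn).ge).finiteDimensional_of_finite
  refine isInternal_of_finrank_le _ _ (R.iSup_summand gen hn) ?_ ?_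
  · rintro (_ | x)
    · classical
      refine (finrank_span_le_card (R := ℝ) ({central n P Q 0, central n P Q 1} : Set L)).trans ?_
      rw [Set.toFinset_insert, Set.toFinset_singleton]
      exact Finset.card_le_two
    · classical
      refine (finrank_span_le_card (R := ℝ)
        ({vecX n P Q x, vecY n P Q x, vecZ n G x} : Set L)).trans ?_
      rw [Set.toFinset_insert, Set.toFinset_insert, Set.toFinset_singleton]
      exact Finset.card_le_three
  · rw [R.finrank_eq gen hn li, Fintype.sum_option]
    simp only [Option.elim, Finset.sum_const, Finset.card_univ, smul_eq_mul]
    rw [← Nat.card_eq_fintype_card, card_root (by omega)]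
    omega

theorem linearIndependent_vec (R : ChainRelations n P Q G) (gen : LieGenerate (Q 0) (P 0))
    (hn : 2 ≤ n) (li : LinearIndependent ℝ (family n P Q G)) (x : Root n) :
    LinearIndependent ℝ ![vecX n P Q x, vecY n P Q x, vecZ n G x] := by
  classical
  rw [linearIndependent_iff_card_eq_finrank_span, Set.finrank]
  have h := (R.isInternal_summand gen hn li).2 (some x)
  have hr : Set.range ![vecX n P Q x, vecY n P Q x, vecZ n G x] =
      {vecX n P Q (x : ℝ), vecY n P Q x, vecZ n G x} := by
    ext w
    simp [Matrix.range_cons]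
    tauto
  rw [hr]
  exact h.symm

theorem center_eq (R : ChainRelations n P Q G) (gen : LieGenerate (Q 0) (P 0))
    (hn : 2 ≤ n) (li : LinearIndependent ℝ (family n P Q G)) :
    LieAlgebra.center ℝ L = R.centralIdeal gen := by
  classical
  have := Fintype.ofFinite (Root n)
  have hint := (R.isInternal_summand gen hn li).1
  have hind := (iSupIndep_iff_finsetSum_eq_zero_imp_eq_zero _).mp hint.submodule_iSupIndep
  have hCle : R.centralIdeal gen ≤ LieAlgebra.center ℝ L := by
    have : (R.centralIdeal gen).toSubmodule ≤ (LieAlgebra.center ℝ L).toSubmodule := by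
      refine Submodule.span_le.mpr ?_
      rintro m (rfl | rfl) <;>
        exact gen.mem_center (R.lie_Q_central _) (R.lie_P_central _)
    exact this
  refine le_antisymm (fun w hw => ?_) hCle
  have htop : w ∈ ⨆ o ∈ Finset.univ, (R.summand gen hn o).toSubmodule := by
    simp [R.iSup_summand gen hn]
  obtain ⟨μ, rfl⟩ := (Submodule.mem_iSup_finset_iff_exists_sum _ _).mp htop
  rw [LieModule.mem_maxTrivSubmodule] at hw
  -- The decomposition consists of ideals, so each component of a central element is central.
  have hcomp : ∀ (y : L) (o), ⁅y, (μ o : L)⁆ = 0 := fun y o =>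
    hind Finset.univ (fun o => ⁅y, (μ o : L)⁆)
      (fun o _ => lie_mem_right ℝ L (R.summand gen hn o) y _ (μ o).2)
      (by rw [← lie_sum]; exact hw y) o (Finset.mem_univ o)
  have hzero : ∀ x : Root n, (μ (some x) : L) = 0 := by
    intro x
    obtain ⟨α, β, γ, h⟩ := Submodule.mem_span_triple.mp (μ (some x)).2
    have hQ := hcomp (Q 0) (some x)
    have hP := hcomp (P 0) (some x)
    rw [← h] at hQ hP
    have hli := R.linearIndependent_vec gen hn li x
    simp only [lie_add, lie_smul, R.lie_Q_vecX hn x.2, R.lie_Q_vecY, R.lie_Q_vecZ,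
      R.lie_P_vecX, R.lie_P_vecY hn x.2, R.lie_P_vecZ] at hQ hP
    obtain ⟨-, h1, h2⟩ := eq_zero_of_linearIndependent_triple hli (α := 0) (β := γ * 4)
      (γ := α * (2 * x) - β * 4) (by rw [← hQ]; module)
    obtain ⟨-, -, h3⟩ := eq_zero_of_linearIndependent_triple hli (α := γ * (-4)) (β := 0)
      (γ := α * 4 - β * (2 * x)) (by rw [← hP]; module)
    have hx := sq_lt_four_of_isRoot (by omega) x.2
    have hα : α * (4 - (x : ℝ) ^ 2) = 0 := by linear_combination h3 - x / 2 * h2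
    have hα0 : α = 0 := (mul_eq_zero.mp hα).resolve_right (by linarith)
    have hβ0 : β = 0 := by rw [hα0] at h2; linarith
    have hγ0 : γ = 0 := by linarith
    rw [← h, hα0, hβ0, hγ0]
    simp
  rw [Fintype.sum_option]
  simp only [hzero, Finset.sum_const_zero, add_zero]
  exact (μ none).2

end ChainRelations

/-! ### Lie algebras with the brackets of the cross product -/

/-- A basis of a real Lie algebra in which the bracket is the cross product. -/
structure IsCrossBasis {M : Type*} [LieRing M] [LieAlgebra ℝ M] (f : Module.Basis (Fin 3) ℝ M) :
    Prop where
  lie01 : ⁅f 0, f 1⁆ = f 2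
  lie12 : ⁅f 1, f 2⁆ = f 0
  lie20 : ⁅f 2, f 0⁆ = f 1

namespace IsCrossBasis
variable {M : Type*} [LieRing M] [LieAlgebra ℝ M] {f : Module.Basis (Fin 3) ℝ M}

theorem lie_eq (hf : IsCrossBasis f) (s t : Fin 3 → ℝ) :
    ⁅s 0 • f 0 + s 1 • f 1 + s 2 • f 2, t 0 • f 0 + t 1 • f 1 + t 2 • f 2⁆ =
      (s 1 * t 2 - s 2 * t 1) • f 0 + (s 2 * t 0 - s 0 * t 2) • f 1 +
        (s 0 * t 1 - s 1 * t 0) • f 2 := by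
  have h10 : ⁅f 1, f 0⁆ = -f 2 := by rw [← lie_skew, hf.lie01]
  have h21 : ⁅f 2, f 1⁆ = -f 0 := by rw [← lie_skew, hf.lie12]
  have h02 : ⁅f 0, f 2⁆ = -f 1 := by rw [← lie_skew, hf.lie20]
  simp only [add_lie, lie_add, smul_lie, lie_smul, lie_self, hf.lie01, hf.lie12, hf.lie20, h10,
    h21, h02]
  module

theorem isSimple (hf : IsCrossBasis f) : LieAlgebra.IsSimple ℝ M where
  eq_bot_or_eq_top I := by
    refine or_iff_not_imp_left.mpr fun hI => ?_
    have top_of : f 0 ∈ I → f 1 ∈ I → f 2 ∈ I → I = ⊤ := by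
      intro h0 h1 h2
      rw [← LieSubmodule.toSubmodule_inj, LieSubmodule.top_toSubmodule, eq_top_iff, ← f.span_eq,
        Submodule.span_le]
      rintro _ ⟨i, rfl⟩
      fin_cases i
      exacts [h0, h1, h2]
    -- An ideal that contains one basis vector contains the others.
    have top0 : f 0 ∈ I → I = ⊤ := fun h0 => by
      have h1 : f 1 ∈ I := hf.lie20 ▸ lie_mem_right ℝ M I _ _ h0
      exact top_of h0 h1 (hf.lie01 ▸ lie_mem_left ℝ M I _ _ h0)
    have top1 : f 1 ∈ I → I = ⊤ := fun h1 =>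
      top0 (hf.lie12 ▸ lie_mem_left ℝ M I _ _ h1)
    obtain ⟨w, hw, hw0⟩ : ∃ w ∈ I, w ≠ 0 := by
      by_contra! h
      exact hI ((LieSubmodule.eq_bot_iff I).mpr h)
    have hsum : w = f.repr w 0 • f 0 + f.repr w 1 • f 1 + f.repr w 2 • f 2 := by
      conv_lhs => rw [← f.sum_repr w, Fin.sum_univ_three]
    set s := f.repr w with hs
    have br := hf.lie_eq
    -- Two brackets with basis vectors isolate each coordinate.
    have e0 : ⁅f 0, ⁅f 1, w⁆⁆ = s 0 • f 1 := by
      have h1 := br ![0, 1, 0] s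
      have h2 := br ![1, 0, 0] ![s 2, 0, -s 0]
      simp only [Matrix.cons_val, zero_smul, one_smul, zero_add, add_zero] at h1 h2
      rw [hsum, h1]
      convert h2 using 1
      · congr 1; module
      · module
    have e1 : ⁅f 1, ⁅f 0, w⁆⁆ = s 1 • f 0 := by
      have h1 := br ![1, 0, 0] s
      have h2 := br ![0, 1, 0] ![0, -s 2, s 1]
      simp only [Matrix.cons_val, zero_smul, one_smul, zero_add, add_zero] at h1 h2
      rw [hsum, h1]
      convert h2 using 1
      · congr 1; module
      · module
    have e2 : ⁅f 2, ⁅f 0, w⁆⁆ = s 2 • f 0 := by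
      have h1 := br ![1, 0, 0] s
      have h2 := br ![0, 0, 1] ![0, -s 2, s 1]
      simp only [Matrix.cons_val, zero_smul, one_smul, zero_add, add_zero] at h1 h2
      rw [hsum, h1]
      convert h2 using 1
      · congr 1; module
      · module
    have mem : ∀ y z : M, ⁅y, ⁅z, w⁆⁆ ∈ I := fun y z =>
      lie_mem_right ℝ M I _ _ (lie_mem_right ℝ M I _ _ hw)
    have cancel : ∀ {c : ℝ} {m : M}, c ≠ 0 → c • m ∈ I → m ∈ I := fun {c m} hc h => by
      have := I.smul_mem c⁻¹ h
      rwa [smul_smul, inv_mul_cancel₀ hc, one_smul] at this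
    by_cases h0 : s 0 = 0
    · by_cases h1 : s 1 = 0
      · by_cases h2 : s 2 = 0
        · rw [h0, h1, h2] at hsum
          exact absurd (by simpa using hsum) hw0
        · exact top0 (cancel h2 (e2 ▸ mem _ _))
      · exact top0 (cancel h1 (e1 ▸ mem _ _))
    · exact top1 (cancel h0 (e0 ▸ mem _ _))
  non_abelian h := by
    have := hf.lie01
    rw [h.trivial] at this
    exact f.ne_zero 2 this.symm

theorem nonempty_lieEquiv {M' : Type*} [LieRing M'] [LieAlgebra ℝ M']
    {f' : Module.Basis (Fin 3) ℝ M'} (hf : IsCrossBasis f) (hf' : IsCrossBasis f') :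
    Nonempty (M ≃ₗ⁅ℝ⁆ M') := by
  let e := f.equiv f' (Equiv.refl _)
  have he : ∀ i, e (f i) = f' i := fun i => f.equiv_apply i f' _
  refine ⟨{ e with map_lie' := ?_ }⟩
  intro x y
  change e ⁅x, y⁆ = ⁅e x, e y⁆
  have hs : ∀ w, w = f.repr w 0 • f 0 + f.repr w 1 • f 1 + f.repr w 2 • f 2 := fun w => by
    conv_lhs => rw [← f.sum_repr w, Fin.sum_univ_three]
  rw [hs x, hs y, hf.lie_eq]
  simp only [map_add, map_smul, he]
  rw [hf'.lie_eq]

theorem exists_of_lie {x y z : M} (hdim : Module.finrank ℝ M = 3)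
    (li : LinearIndependent ℝ ![x, y, z]) (hxy : ⁅x, y⁆ = z) (hyz : ⁅y, z⁆ = x)
    (hzx : ⁅z, x⁆ = y) : ∃ f : Module.Basis (Fin 3) ℝ M, IsCrossBasis f := by
  let f := basisOfLinearIndependentOfCardEqFinrank li (by rw [hdim]; rfl)
  have hf : ∀ i, f i = ![x, y, z] i := fun i => by
    simp [f]
  exact ⟨f, by rw [hf, hf, hf]; exact hxy, by rw [hf, hf, hf]; exact hyz,
    by rw [hf, hf, hf]; exact hzx⟩

end IsCrossBasis

/-- The coordinates of a matrix in `su(2)` with respect to `iσ_x / 2, iσ_y / 2, iσ_z / 2`. -/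
def su2Equiv : su2 ≃ₗ[ℝ] (Fin 3 → ℝ) where
  toFun M := ![2 * ((M : Matrix (Fin 2) (Fin 2) ℂ) 0 1).im,
    -2 * ((M : Matrix (Fin 2) (Fin 2) ℂ) 0 1).re,
    2 * ((M : Matrix (Fin 2) (Fin 2) ℂ) 0 0).im]
  map_add' M N := by
    ext i; fin_cases i <;> simp <;> ring
  map_smul' c M := by
    ext i; fin_cases i <;> simp <;> ring
  invFun t := ⟨!![⟨0, t 2 / 2⟩, ⟨-t 1 / 2, t 0 / 2⟩; ⟨t 1 / 2, t 0 / 2⟩, ⟨0, -t 2 / 2⟩], by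
    constructor
    · ext i j
      fin_cases i <;> fin_cases j <;> simp [Complex.ext_iff] <;> ring
    · rw [Matrix.trace_fin_two]
      simp [Complex.ext_iff]; ring⟩
  left_inv M := by
    obtain ⟨M, h1, h2⟩ := M
    have h00 := congrFun (congrFun h1 0) 0
    have h01 := congrFun (congrFun h1 1) 0
    rw [Matrix.trace_fin_two] at h2
    simp only [Matrix.conjTranspose_apply, Matrix.neg_apply, Complex.ext_iff, RCLike.star_def,
      Complex.conj_re, Complex.conj_im, Complex.neg_re, Complex.neg_im] at h00 h01
    rw [Complex.ext_iff] at h2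
    simp only [Complex.add_re, Complex.add_im, Complex.zero_re, Complex.zero_im] at h2
    ext i j
    fin_cases i <;> fin_cases j <;> simp [Complex.ext_iff] <;>
      first | linarith | (constructor <;> linarith)
  right_inv t := by
    ext i; fin_cases i <;> simp <;> ring

theorem isCrossBasis_su2 : IsCrossBasis (Module.Basis.ofEquivFun su2Equiv) := by
  constructor <;>
  · rw [Module.Basis.coe_ofEquivFun]
    ext i j
    fin_cases i <;> fin_cases j <;>
      simp [su2Equiv, Ring.lie_def, Complex.ext_iff] <;> norm_num

/-! ### The brackets of `X̂_x, Ŷ_x, Ẑ_x` -/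

section
variable {L : Type*} [LieRing L] [LieAlgebra ℝ L] {u v x y z : L} {r : ℝ}

/-- If `x, y, z` span an ideal on which `u` and `v` act by the given formulas, then the derivation
property of `⁅u, ·⁆` and `⁅v, ·⁆` determines the brackets of `x, y, z` up to a common factor. -/
theorem exists_lie_eq (li : LinearIndependent ℝ ![x, y, z]) (hr : r ^ 2 < 4)
    (hux : ⁅u, x⁆ = (2 * r) • z) (huy : ⁅u, y⁆ = (-4 : ℝ) • z) (huz : ⁅u, z⁆ = (4 : ℝ) • y)
    (hvx : ⁅v, x⁆ = (4 : ℝ) • z) (hvy : ⁅v, y⁆ = (-2 * r) • z) (hvz : ⁅v, z⁆ = (-4 : ℝ) • x)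
    (hyz : ⁅y, z⁆ ∈ Submodule.span ℝ {x, y, z}) (hzx : ⁅z, x⁆ ∈ Submodule.span ℝ {x, y, z}) :
    ∃ c : ℝ, ⁅y, z⁆ = c • (x + (r / 2) • y) ∧ ⁅z, x⁆ = c • (y + (r / 2) • x) ∧
      ⁅x, y⁆ = (c * (1 - r ^ 2 / 4)) • z := by
  obtain ⟨α, β, γ, hp⟩ := Submodule.mem_span_triple.mp hyz
  obtain ⟨α', β', γ', hq⟩ := Submodule.mem_span_triple.mp hzx
  have hyx : ⁅y, x⁆ = -⁅x, y⁆ := (lie_skew y x).symm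
  -- `ad u` kills `⁅y, z⁆`, and `ad v` kills `⁅z, x⁆`.
  have h1 : ⁅u, ⁅y, z⁆⁆ = 0 := by
    rw [leibniz_lie, huy, huz, smul_lie, lie_smul, lie_self, lie_self]; simp
  have h2 : ⁅v, ⁅z, x⁆⁆ = 0 := by
    rw [leibniz_lie, hvz, hvx, smul_lie, lie_smul, lie_self, lie_self]; simp
  have h3 : ⁅u, ⁅z, x⁆⁆ = (-4 : ℝ) • ⁅x, y⁆ := by
    rw [leibniz_lie, huz, hux, smul_lie, lie_smul, lie_self, hyx]; module
  have h4 : ⁅v, ⁅y, z⁆⁆ = (4 : ℝ) • ⁅x, y⁆ := by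
    rw [leibniz_lie, hvz, hvy, smul_lie, lie_smul, lie_self, hyx]; module
  rw [← hp] at h1 h4
  rw [← hq] at h2 h3
  simp only [lie_add, lie_smul, hux, huy, huz, hvx, hvy, hvz] at h1 h2 h3 h4
  obtain ⟨-, hγ, hβ⟩ := eq_zero_of_linearIndependent_triple li (α := 0) (β := γ * 4)
    (γ := α * (2 * r) - β * 4) (by rw [← h1]; module)
  obtain ⟨hγ', -, hα'⟩ := eq_zero_of_linearIndependent_triple li (α := γ' * (-4)) (β := 0)
    (γ := α' * 4 - β' * (2 * r)) (by rw [← h2]; module)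
  have hγ0 : γ = 0 := by linarith
  have hγ0' : γ' = 0 := by linarith
  have hβe : β = α * (r / 2) := by linarith
  have hαe : α' = β' * (r / 2) := by linarith
  subst hγ0 hγ0' hβe hαe
  have h5 : ⁅x, y⁆ = (α * (1 - r ^ 2 / 4)) • z := by
    have : ⁅x, y⁆ = (4⁻¹ : ℝ) • ((4 : ℝ) • ⁅x, y⁆) := by module
    rw [this, ← h4]; module
  have h6 : ⁅x, y⁆ = (β' * (1 - r ^ 2 / 4)) • z := by
    have : ⁅x, y⁆ = (-4⁻¹ : ℝ) • ((-4 : ℝ) • ⁅x, y⁆) := by module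
    rw [this, ← h3]; module
  obtain ⟨-, -, h7⟩ := eq_zero_of_linearIndependent_triple li (α := 0) (β := 0)
    (γ := α * (1 - r ^ 2 / 4) - β' * (1 - r ^ 2 / 4)) (by rw [sub_smul, ← h5, ← h6]; simp)
  rw [← sub_mul] at h7
  have h8 : α = β' := by
    have := (mul_eq_zero.mp h7).resolve_right (by linarith)
    linarith
  subst h8
  exact ⟨α, by rw [← hp]; module, by rw [← hq]; module, h5⟩

/-- The elements `x + (r / 2) y, y, z` are orthogonal for the invariant form; the factors below,
with `s = √(1 - r² / 4)`, normalize them. The condition `r ^ 2 < 4` gives the compact real form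
`su(2)`, for either sign of `c`. -/
theorem exists_isCrossBasis (hdim : Module.finrank ℝ L = 3) (li : LinearIndependent ℝ ![x, y, z])
    (hr : r ^ 2 < 4) {c : ℝ} (hc : c ≠ 0) (hyz : ⁅y, z⁆ = c • (x + (r / 2) • y))
    (hzx : ⁅z, x⁆ = c • (y + (r / 2) • x)) (hxy : ⁅x, y⁆ = (c * (1 - r ^ 2 / 4)) • z) :
    ∃ f : Module.Basis (Fin 3) ℝ L, IsCrossBasis f := by
  obtain ⟨s, hs, hs2⟩ : ∃ s : ℝ, 0 < s ∧ s ^ 2 = 1 - r ^ 2 / 4 :=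
    ⟨√(1 - r ^ 2 / 4), Real.sqrt_pos.mpr (by linarith), Real.sq_sqrt (by linarith)⟩
  have hzy : ⁅z, y⁆ = -(c • (x + (r / 2) • y)) := by rw [← lie_skew, hyz]
  have hs0 := hs.ne'
  refine IsCrossBasis.exists_of_lie (x := (c * s ^ 2)⁻¹ • (x + (r / 2) • y))
    (y := (c * s)⁻¹ • y) (z := (c * s)⁻¹ • z) hdim ?_ ?_ ?_ ?_
  · rw [Fintype.linearIndependent_iff]
    intro g hg
    rw [Fin.sum_univ_three] at hg
    simp only [Matrix.cons_val] at hg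
    obtain ⟨h0, h1, h2⟩ := eq_zero_of_linearIndependent_triple li (α := g 0 * (c * s ^ 2)⁻¹)
      (β := g 0 * (c * s ^ 2)⁻¹ * (r / 2) + g 1 * (c * s)⁻¹) (γ := g 2 * (c * s)⁻¹)
      (by rw [← hg]; module)
    rw [h0, zero_mul, zero_add] at h1
    have e1 : (c * s ^ 2)⁻¹ ≠ 0 := by positivity
    have e2 : (c * s)⁻¹ ≠ 0 := by positivity
    intro i
    fin_cases i
    · exact (mul_eq_zero.mp h0).resolve_right e1
    · exact (mul_eq_zero.mp h1).resolve_right e2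
    · exact (mul_eq_zero.mp h2).resolve_right e2
  · rw [smul_lie, lie_smul, add_lie, smul_lie, lie_self, smul_zero, add_zero, hxy, ← hs2, smul_smul,
      smul_smul]
    congr 1; field_simp
  · rw [smul_lie, lie_smul, hyz, smul_smul, smul_smul]
    congr 1; field_simp
  · rw [smul_lie, lie_smul, lie_add, lie_smul, hzx, hzy]
    have e : c • (y + (r / 2) • x) + (r / 2) • -(c • (x + (r / 2) • y)) = (c * s ^ 2) • y := by
      rw [hs2]; module
    rw [e, smul_smul, smul_smul]
    congr 1; field_simp

end

namespace ChainRelations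
variable {L : Type*} [LieRing L] [LieAlgebra ℝ L] {n : ℕ} {P Q G : ℕ → L}

theorem exists_lie_vec (R : ChainRelations n P Q G) (gen : LieGenerate (Q 0) (P 0))
    (hn : 2 ≤ n) (li : LinearIndependent ℝ (family n P Q G)) (x : Root n) :
    ∃ c : ℝ, c ≠ 0 ∧
      ⁅vecY n P Q x, vecZ n G x⁆ = c • (vecX n P Q x + ((x : ℝ) / 2) • vecY n P Q x) ∧
      ⁅vecZ n G x, vecX n P Q x⁆ = c • (vecY n P Q x + ((x : ℝ) / 2) • vecX n P Q x) ∧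
      ⁅vecX n P Q x, vecY n P Q x⁆ = (c * (1 - (x : ℝ) ^ 2 / 4)) • vecZ n G x := by
  classical
  have li3 := R.linearIndependent_vec gen hn li x
  obtain ⟨hX, hY, hZ⟩ := R.mem_rootIdeal gen hn x
  obtain ⟨c, h1, h2, h3⟩ := exists_lie_eq li3 (sq_lt_four_of_isRoot (by omega) x.2)
    (R.lie_Q_vecX hn x.2) (R.lie_Q_vecY x) (R.lie_Q_vecZ x)
    (R.lie_P_vecX x) (R.lie_P_vecY hn x.2) (R.lie_P_vecZ x)
    (lie_mem_right ℝ L (R.rootIdeal gen hn x) _ _ hZ)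
    (lie_mem_right ℝ L (R.rootIdeal gen hn x) _ _ hX)
  refine ⟨c, ?_, h1, h2, h3⟩
  -- If `c = 0`, then `vecZ` commutes with every summand, hence is central.
  rintro rfl
  have hind := (R.isInternal_summand gen hn li).1.submodule_iSupIndep
  have hker : ⨆ o, (R.summand gen hn o).toSubmodule ≤
      LinearMap.ker (LieModule.toEnd ℝ L L (vecZ n G x) : L →ₗ[ℝ] L) := by
    refine iSup_le ?_
    rintro (_ | y)
    · intro w hw
      rw [LinearMap.mem_ker, LieModule.toEnd_apply_apply]
      have hw' : w ∈ LieAlgebra.center ℝ L := by rw [R.center_eq gen hn li]; exact hw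
      exact (LieModule.mem_maxTrivSubmodule ..).mp hw' _
    · by_cases hy : y = x
      · subst hy
        refine Submodule.span_le.mpr ?_
        rintro m (rfl | rfl | rfl)
        · simpa using h2
        · rw [SetLike.mem_coe, LinearMap.mem_ker, LieModule.toEnd_apply_apply, ← lie_skew, h1]
          simp
        · simp
      · intro w hw
        rw [LinearMap.mem_ker, LieModule.toEnd_apply_apply]
        have hd := hind.pairwiseDisjoint (show some x ≠ some y by simpa using Ne.symm hy)
        refine Submodule.disjoint_def.mp hd _ ?_ ?_
        · exact lie_mem_left ℝ L (R.rootIdeal gen hn x) _ _ hZ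
        · exact lie_mem_right ℝ L (R.rootIdeal gen hn y) _ _ hw
  rw [R.iSup_summand gen hn] at hker
  have h0 : ⁅Q 0, vecZ n G (x : ℝ)⁆ = 0 := by
    have := hker (Submodule.mem_top (x := Q 0))
    rw [LinearMap.mem_ker, LieModule.toEnd_apply_apply] at this
    rw [← lie_skew, this, neg_zero]
  rw [R.lie_Q_vecZ] at h0
  obtain ⟨-, h4, -⟩ := eq_zero_of_linearIndependent_triple li3 (α := 0) (β := 4) (γ := 0)
    (by rw [← h0]; module)
  norm_num at h4

/-- The ideal of a root has the basis `X̂_x, Ŷ_x, Ẑ_x` and a basis with the brackets of the cross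
product. -/
theorem rootIdeal_spec (R : ChainRelations n P Q G) (gen : LieGenerate (Q 0) (P 0))
    (hn : 2 ≤ n) (li : LinearIndependent ℝ (family n P Q G)) (x : Root n) :
    (∃ b : Module.Basis (Fin 3) ℝ (R.rootIdeal gen hn x),
      (b 0 : L) = vecX n P Q x ∧ (b 1 : L) = vecY n P Q x ∧ (b 2 : L) = vecZ n G x) ∧
    ∃ f : Module.Basis (Fin 3) ℝ (R.rootIdeal gen hn x), IsCrossBasis f := by
  classical
  obtain ⟨hX, hY, hZ⟩ := R.mem_rootIdeal gen hn x
  have hdim : Module.finrank ℝ (R.rootIdeal gen hn x) = 3 :=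
    (R.isInternal_summand gen hn li).2 (some x)
  have li3 : LinearIndependent ℝ (![⟨_, hX⟩, ⟨_, hY⟩, ⟨_, hZ⟩] : Fin 3 → R.rootIdeal gen hn x) := by
    refine LinearIndependent.of_comp (R.rootIdeal gen hn x).toSubmodule.subtype ?_
    convert R.linearIndependent_vec gen hn li x using 1
    ext i; fin_cases i <;> rfl
  constructor
  · refine ⟨basisOfLinearIndependentOfCardEqFinrank li3 (by rw [hdim]; rfl), ?_, ?_, ?_⟩ <;> simp
  · obtain ⟨c, hc, h1, h2, h3⟩ := R.exists_lie_vec gen hn li x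
    exact exists_isCrossBasis hdim li3 (sq_lt_four_of_isRoot (by omega) x.2) hc
      (Subtype.ext h1) (Subtype.ext h2) (Subtype.ext h3)

theorem restrict {K : LieSubalgebra ℝ L} {P Q G : ℕ → K}
    (R : ChainRelations n (fun k => (P k : L)) (fun k => (Q k : L)) fun k => (G k : L)) :
    ChainRelations n P Q G where
  G_zero := Subtype.ext R.G_zero
  G_last := Subtype.ext R.G_last
  lie_Q_P k := Subtype.ext (R.lie_Q_P k)
  lie_Q_Q k := Subtype.ext (R.lie_Q_Q k)
  lie_Q_G k := Subtype.ext (R.lie_Q_G k)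
  lie_P_P k := Subtype.ext (R.lie_P_P k)
  lie_P_Q k := Subtype.ext (R.lie_P_Q k)
  lie_P_G k := Subtype.ext (R.lie_P_G k)

end ChainRelations

section
variable {n : ℕ} [NeZero n]

/-! ### The dynamical Lie algebra -/

theorem chainRelations_op (hn : 3 ≤ n) : ChainRelations n (opP n) (opQ n) (opG n) where
  G_zero := opG_zero
  G_last := opG_last hn
  lie_Q_P := lie_opQ_zero_opP hn
  lie_Q_Q := lie_opQ_zero_opQ hn
  lie_Q_G := lie_opQ_zero_opG hn
  lie_P_P := lie_opP_zero_opP hn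
  lie_P_Q := lie_opP_zero_opQ hn
  lie_P_G := lie_opP_zero_opG hn

theorem op_mem_dla (hn : 3 ≤ n) (k : ℕ) : opP n k ∈ dla n ∧ opQ n k ∈ dla n ∧ opG n k ∈ dla n := by
  refine (chainRelations_op hn).mem_of_generators _ ?_ ?_ k
  · rw [opQ_zero_eq_H1]
    exact (dla n).neg_mem (LieSubalgebra.subset_lieSpan (by simp))
  · rw [opP_zero]
    exact LieSubalgebra.subset_lieSpan (by simp)

/-- `opP` as a sequence in the dynamical Lie algebra. -/
def dlaP (hn : 3 ≤ n) (k : ℕ) : dla n := ⟨opP n k, (op_mem_dla hn k).1⟩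

/-- `opQ` as a sequence in the dynamical Lie algebra. -/
def dlaQ (hn : 3 ≤ n) (k : ℕ) : dla n := ⟨opQ n k, (op_mem_dla hn k).2.1⟩

/-- `opG` as a sequence in the dynamical Lie algebra. -/
def dlaG (hn : 3 ≤ n) (k : ℕ) : dla n := ⟨opG n k, (op_mem_dla hn k).2.2⟩

theorem chainRelations_dla (hn : 3 ≤ n) : ChainRelations n (dlaP hn) (dlaQ hn) (dlaG hn) :=
  ChainRelations.restrict (chainRelations_op hn)

theorem lieGenerate_dla (hn : 3 ≤ n) : LieGenerate (dlaQ hn 0) (dlaP hn 0) := by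
  intro K hQ hP
  have hle : dla n ≤ K.map (dla n).incl := by
    refine LieSubalgebra.lieSpan_le.mpr ?_
    rintro m (rfl | rfl)
    · exact ⟨dlaP hn 0, hP, opP_zero⟩
    · refine ⟨-dlaQ hn 0, K.neg_mem hQ, ?_⟩
      change -opQ n 0 = _
      rw [opQ_zero_eq_H1, neg_neg]
  rw [eq_top_iff]
  intro y _
  obtain ⟨w, hw, he⟩ := hle y.2
  rwa [← Subtype.ext he]

open ChainRelations

theorem coe_family_dla (hn : 3 ≤ n) (l : Label n) :
    ((family n (dlaP hn) (dlaQ hn) (dlaG hn) l : dla n) : Op n) = basisFamily n l := by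
  rcases l with k | k | k | _ | _
  · exact opQ_succ hn (by omega)
  · exact opP_of_lt hn (by omega)
  · exact opG_succ hn (by omega)
  · change -opQ n 0 = bX n
    rw [opQ_zero hn, neg_neg]
  · exact opP_last hn

theorem linearIndependent_family_dla (hn : 3 ≤ n) :
    LinearIndependent ℝ (family n (dlaP hn) (dlaQ hn) (dlaG hn)) := by
  refine LinearIndependent.of_comp ((dla n).incl : dla n →ₗ[ℝ] Op n) ?_
  have h : ((dla n).incl : dla n →ₗ[ℝ] Op n) ∘ family n (dlaP hn) (dlaQ hn) (dlaG hn) =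
      basisFamily n := funext (coe_family_dla hn)
  rw [h]
  exact linearIndependent_basisFamily hn

theorem coe_central_dla (hn : 3 ≤ n) (e : ℕ) :
    ((central n (dlaP hn) (dlaQ hn) e : dla n) : Op n) =
      ((if Even e then -bX n else 0) + (if Even (n - 1 + e) then 0 else bXX n)) +
      ∑ k ∈ (Finset.range (n - 1)).filter (fun k => ¬ Even (k + e)), (bY n k + bZ n k) := by
  have h : ((central n (dlaP hn) (dlaQ hn) e : dla n) : Op n) =
      ∑ k ∈ Finset.range n, ((if Even (k + e) then opQ n k else 0) +
        if Even (k + e) then 0 else opP n k) := by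
    rw [central]
    refine (map_sum (dla n).toSubmodule.subtype _ _).trans (Finset.sum_congr rfl fun k _ => ?_)
    split_ifs
    · exact (add_zero _).symm
    · exact (zero_add _).symm
  have hY : ∑ k ∈ Finset.range (n - 1), (if Even (k + 1 + e) then opQ n (k + 1) else 0) =
      ∑ k ∈ Finset.range (n - 1), if ¬ Even (k + e) then bY n k else 0 := by
    refine Finset.sum_congr rfl fun k hk => ?_
    rw [Finset.mem_range] at hk
    rw [opQ_succ hn (by omega)]
    exact if_congr (by grind) rfl rfl
  have hZ : ∑ k ∈ Finset.range (n - 1), (if Even (k + e) then 0 else opP n k) =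
      ∑ k ∈ Finset.range (n - 1), if ¬ Even (k + e) then bZ n k else 0 := by
    refine Finset.sum_congr rfl fun k hk => ?_
    rw [Finset.mem_range] at hk
    rw [opP_of_lt hn (by omega), ite_not]
  have first : ∀ f : ℕ → Op n, ∑ k ∈ Finset.range n, f k =
      ∑ k ∈ Finset.range (n - 1), f (k + 1) + f 0 := fun f => by
    rw [← Finset.sum_range_succ', Nat.sub_add_cancel (by omega)]
  have last : ∀ f : ℕ → Op n, ∑ k ∈ Finset.range n, f k =
      ∑ k ∈ Finset.range (n - 1), f k + f (n - 1) := fun f => by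
    rw [← Finset.sum_range_succ, Nat.sub_add_cancel (by omega)]
  rw [h, Finset.sum_add_distrib, first, last, hY, hZ, zero_add, opQ_zero hn, opP_last hn,
    Finset.sum_add_distrib, Finset.sum_filter, Finset.sum_filter]
  abel

theorem coe_central_zero_dla (hn : 3 ≤ n) :
    ((central n (dlaP hn) (dlaQ hn) 0 : dla n) : Op n) = center1 n := by
  rw [coe_central_dla, center1]
  simp only [add_zero, Even.zero, if_true, Nat.not_even_iff_odd]
  congr 1
  by_cases h : Odd n
  · rw [if_pos h, if_pos (by grind), add_zero]
  · rw [if_neg h, if_neg (by grind)]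

theorem coe_central_one_dla (hn : 3 ≤ n) :
    ((central n (dlaP hn) (dlaQ hn) 1 : dla n) : Op n) = center2 n := by
  rw [coe_central_dla, center2, Nat.sub_add_cancel (by omega), if_neg (by decide), zero_add]
  simp only [Nat.even_add_one, not_not]
  congr 1
  by_cases h : Odd n
  · rw [if_pos h, if_neg (by grind)]
  · rw [if_neg h, if_pos (by grind)]

theorem coe_vecX_dla (hn : 3 ≤ n) (x : ℝ) :
    ((vecX n (dlaP hn) (dlaQ hn) x : dla n) : Op n) = hatX n x := by
  have h : ((vecX n (dlaP hn) (dlaQ hn) x : dla n) : Op n) =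
      ∑ k ∈ Finset.range (n - 1), (a k).eval x • (opP n (k + 1) - opQ n k) := by
    rw [vecX]
    exact map_sum (dla n).toSubmodule.subtype _ _
  have hIcc : Finset.Icc 1 (n - 3) = (Finset.range (n - 3)).image (· + 1) := by
    ext k
    simp only [Finset.mem_Icc, Finset.mem_image, Finset.mem_range]
    exact ⟨fun h => ⟨k - 1, by omega, by omega⟩, by rintro ⟨j, hj, rfl⟩; omega⟩
  rw [h, hatX, hIcc, Finset.sum_image fun i _ j _ h => add_right_cancel h,
    show n - 1 = n - 3 + 1 + 1 by omega, Finset.sum_range_succ, Finset.sum_range_succ',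
    show n - 3 + 1 + 1 = n - 1 by omega, opP_last hn, opQ_zero hn, opQ_succ hn (by omega),
    opP_of_lt hn (by omega), show n - 3 + 1 = n - 2 by omega, sub_neg_eq_add]
  have hs : ∑ k ∈ Finset.range (n - 3), (a (k + 1)).eval x • (opP n (k + 1 + 1) - opQ n (k + 1)) =
      ∑ k ∈ Finset.range (n - 3), (a (k + 1)).eval x • (bZ n (k + 1 + 1) - bY n (k + 1 - 1)) := by
    refine Finset.sum_congr rfl fun k hk => ?_
    rw [Finset.mem_range] at hk
    rw [opP_of_lt hn (by omega), opQ_succ hn (by omega), Nat.add_sub_cancel]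
  rw [hs, add_comm (bX n)]
  abel

theorem coe_vecY_dla (hn : 3 ≤ n) (x : ℝ) :
    ((vecY n (dlaP hn) (dlaQ hn) x : dla n) : Op n) = hatY n x := by
  rw [vecY, hatY]
  refine (map_sum (dla n).toSubmodule.subtype _ _).trans (Finset.sum_congr rfl fun k hk => ?_)
  rw [Finset.mem_range] at hk
  change (a k).eval x • (opQ n (k + 1) - opP n k) = _
  rw [opP_of_lt hn (by omega), opQ_succ hn (by omega)]

theorem coe_vecZ_dla (hn : 3 ≤ n) (x : ℝ) : ((vecZ n (dlaG hn) x : dla n) : Op n) = hatZ n x := by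
  rw [vecZ, hatZ]
  refine (map_sum (dla n).toSubmodule.subtype _ _).trans (Finset.sum_congr rfl fun k hk => ?_)
  rw [Finset.mem_range] at hk
  change (a k).eval x • opG n (k + 1) = _
  rw [opG_succ hn (by omega)]

end

end IsingChain

end

open IsingChain ChainRelations in
theorem mainTheorem1 (n : ℕ) (hn : 3 ≤ n) :
    -- the dimension and the explicit basis of the dynamical Lie algebra
    Module.finrank ℝ (IsingChain.dla n) = 3 * n - 1 ∧
    (∃ b : Module.Basis (IsingChain.Label n) ℝ (IsingChain.dla n),
      ∀ l, (b l : IsingChain.Op n) = IsingChain.basisFamily n l) ∧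
    -- the center is two dimensional, with explicit spanning elements
    Module.finrank ℝ (LieAlgebra.center ℝ (IsingChain.dla n)) = 2 ∧
    (LieAlgebra.center ℝ (IsingChain.dla n)).toSubmodule.map (IsingChain.dla n).toSubmodule.subtype
      = Submodule.span ℝ {IsingChain.center1 n, IsingChain.center2 n} ∧
    -- the roots: all of them are real and simple, and they are the eigenvalues of `A_{n-1}`
    (IsingChain.a (n - 1)).natDegree = n - 1 ∧
    Nat.card (IsingChain.Root n) = n - 1 ∧
    (∀ x : ℝ, (IsingChain.a (n - 1)).IsRoot x ↔
      Module.End.HasEigenvalue (Matrix.toLin' (IsingChain.A (n - 1))) x) ∧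
    -- the simple ideals, indexed by the roots, and the direct sum decomposition
    ∃ J : IsingChain.Root n → LieIdeal ℝ (IsingChain.dla n),
      (∀ x : IsingChain.Root n,
        (∃ b : Module.Basis (Fin 3) ℝ (J x),
          ((b 0 : IsingChain.dla n) : IsingChain.Op n) = IsingChain.hatX n x ∧
          ((b 1 : IsingChain.dla n) : IsingChain.Op n) = IsingChain.hatY n x ∧
          ((b 2 : IsingChain.dla n) : IsingChain.Op n) = IsingChain.hatZ n x) ∧
        LieAlgebra.IsSimple ℝ (J x) ∧
        Nonempty (J x ≃ₗ⁅ℝ⁆ IsingChain.su2)) ∧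
      DirectSum.IsInternal (fun o : Option (IsingChain.Root n) =>
        o.elim (LieAlgebra.center ℝ (IsingChain.dla n)).toSubmodule (fun x => (J x).toSubmodule)) := by
  have : NeZero n := ⟨by omega⟩
  have hn2 : 2 ≤ n := by omega
  have R := chainRelations_dla hn
  have gen := lieGenerate_dla hn
  have li := linearIndependent_family_dla hn
  have hcenter := R.center_eq gen hn2 li
  obtain ⟨hint, hrank⟩ := R.isInternal_summand gen hn2 li
  refine ⟨R.finrank_eq gen hn2 li, ⟨Module.Basis.mk li (R.span_family gen hn2).ge, fun l => ?_⟩,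
    ?_, ?_, natDegree_a _, card_root (by omega), isRoot_a_iff_hasEigenvalue (by omega),
    R.rootIdeal gen hn2, fun x => ?_, ?_⟩
  · rw [Module.Basis.mk_apply, coe_family_dla]
  · rw [hcenter]; exact hrank none
  · rw [hcenter]
    change Submodule.map _ (Submodule.span ℝ _) = _
    rw [Submodule.map_span, Set.image_pair, ← coe_central_zero_dla hn, ← coe_central_one_dla hn]
    rfl
  · obtain ⟨⟨b, h0, h1, h2⟩, f, hf⟩ := R.rootIdeal_spec gen hn2 li x
    refine ⟨⟨b, ?_, ?_, ?_⟩, hf.isSimple, hf.nonempty_lieEquiv isCrossBasis_su2⟩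
    · rw [h0, coe_vecX_dla]
    · rw [h1, coe_vecY_dla]
    · rw [h2, coe_vecZ_dla]
  · convert hint using 2 with o
    rcases o with _ | x
    · exact congrArg LieSubmodule.toSubmodule hcenter
    · rfl
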